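/- Let $n\ge 1$, $s\in(0,1)$, and let $\Omega\subset\mathbb{R}^n$ be a bounded open set (in particular, any bounded domain with $C^{1,1}$ boundary). Let $$\mathcal{H}_0^s(\Omega)=\Big\{u\in L^2(\mathbb{R}^n)\ :\ \frac{u(x)-u(y)}{|x-y|^{\frac n2+s}}\in L^2(\mathbb{R}^n\times\mathbb{R}^n),\ u=0 \text{ a.e. in } \mathbb{R}^n\smallsetminus\Omega\Big\}$$ (real-valued functions), and for $u,v\in\mathcal{H}_0^s(\Omega)$ let $$\mathcal{E}_s(u,v)=\frac{C_{n,s}}{2}\int_{\mathbb{R}^n}\int_{\mathbb{R}^n}\frac{(u(x)-u(y))(v(x)-v(y))}{|x-y|^{n+2s}}\,dx\,dy,\qquad C_{n,s}=\frac{s\,4^s\,\Gamma(s+\frac n2)}{\pi^{n/2}\,\Gamma(1-s)}.$$ Given a continuous weight $w:\mathbb{R}^n\to\mathbb{R}$, a number $\lambda\in\mathbb{R}$ is called an eigenvalue of the problem $$(-\Delta)^s\varphi=\lambda w\varphi\ \text{ in }\Omega,\qquad \varphi=0\ \text{ in }\mathbb{R}^n\smallsetminus\Omega,$$ if there is $\varphi\in\mathcal{H}_0^s(\Omega)$,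 $\varphi\neq0$, with $\mathcal{E}_s(\varphi,v)=\lambda\int_\Omega w\varphi v\,dx$ for all $v\in\mathcal{H}_0^s(\Omega)$; it is called simple if the vector space of all such $\varphi$, together with $0$, has dimension one. Let $\alpha:\mathbb{R}^n\to\mathbb{R}$ be continuous with $\alpha>0$ on $\overline\Omega$, that is, $\min_{\overline\Omega}\alpha>0$ if $\Omega\ne\emptyset$. Then for every $\varepsilon>0$ there is a bounded continuous function $\beta:\mathbb{R}^n\to\mathbb{R}$ with $\|\beta\|_{C^0}=\sup_{\mathbb{R}^n}|\beta|<\varepsilon$ such that every eigenvalue of the problem $$(-\Delta)^s\varphi=\lambda(\alpha+\beta)\varphi\ \text{ in }\Omega,\qquad \varphi=0\ \text{ in }\mathbb{R}^n\smallsetminus\Omega,$$ is simple. -/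

import Mathlib

open MeasureTheory
open scoped ENNReal BoundedContinuousFunction

/-- The normalisation constant
`C_{n,s} = s 4^s Γ(s + n/2) / (π^{n/2} Γ(1 - s))` of the fractional Laplacian. -/
noncomputable def fracLaplacianConst (n : ℕ) (s : ℝ) : ℝ :=
  s * (4 : ℝ) ^ s * Real.Gamma (s + (n : ℝ) / 2) /
    (Real.pi ^ ((n : ℝ) / 2) * Real.Gamma (1 - s))

/-- The quotient `(u(x) - u(y)) / |x - y|^{n/2 + s}` on `ℝⁿ × ℝⁿ`. -/
noncomputable def diffQuotient {n : ℕ} (s : ℝ) (u : EuclideanSpace ℝ (Fin n) → ℝ)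
    (p : EuclideanSpace ℝ (Fin n) × EuclideanSpace ℝ (Fin n)) : ℝ :=
  (u p.1 - u p.2) / ‖p.1 - p.2‖ ^ ((n : ℝ) / 2 + s)

/-- The form
`𝓔_s(u, v) = (C_{n,s} / 2) ∬ (u(x) - u(y)) (v(x) - v(y)) / |x - y|^{n + 2s} dx dy`. -/
noncomputable def fracForm {n : ℕ} (s : ℝ) (u v : EuclideanSpace ℝ (Fin n) → ℝ) : ℝ :=
  fracLaplacianConst n s / 2 *
    ∫ p : EuclideanSpace ℝ (Fin n) × EuclideanSpace ℝ (Fin n),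
      (u p.1 - u p.2) * (v p.1 - v p.2) / ‖p.1 - p.2‖ ^ ((n : ℝ) + 2 * s)

theorem diffQuotient_congr {n : ℕ} (s : ℝ) {u v : EuclideanSpace ℝ (Fin n) → ℝ}
    (h : u =ᵐ[volume] v) : diffQuotient s u =ᵐ[volume] diffQuotient s v := by
  have h1 := (Measure.quasiMeasurePreserving_fst
    (μ := (volume : Measure (EuclideanSpace ℝ (Fin n))))
    (ν := (volume : Measure (EuclideanSpace ℝ (Fin n))))).ae_eq_comp h
  have h2 := (Measure.quasiMeasurePreserving_snd
    (μ := (volume : Measure (EuclideanSpace ℝ (Fin n))))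
    (ν := (volume : Measure (EuclideanSpace ℝ (Fin n))))).ae_eq_comp h
  rw [Measure.volume_eq_prod]
  filter_upwards [h1, h2] with p hp1 hp2
  simp only [Function.comp_apply] at hp1 hp2
  simp only [diffQuotient, hp1, hp2]

theorem fracForm_eq_integral_diffQuotient {n : ℕ} (s : ℝ)
    (u v : EuclideanSpace ℝ (Fin n) → ℝ) :
    fracForm s u v = fracLaplacianConst n s / 2 *
      ∫ p : EuclideanSpace ℝ (Fin n) × EuclideanSpace ℝ (Fin n),
        diffQuotient s u p * diffQuotient s v p := by
  unfold fracForm diffQuotient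
  congr 2
  funext p
  rw [div_mul_div_comm, ← sq, ← Real.rpow_mul_natCast (norm_nonneg _)]
  congr 2
  push_cast
  ring

theorem diffQuotient_add {n : ℕ} (s : ℝ) (u v : EuclideanSpace ℝ (Fin n) → ℝ) :
    diffQuotient s (u + v) = diffQuotient s u + diffQuotient s v := by
  funext p
  simp only [diffQuotient, Pi.add_apply]
  ring

theorem diffQuotient_smul {n : ℕ} (s c : ℝ) (u : EuclideanSpace ℝ (Fin n) → ℝ) :
    diffQuotient s (c • u) = c • diffQuotient s u := by
  funext p
  simp only [diffQuotient, Pi.smul_apply, smul_eq_mul]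
  ring

/-- The space `𝓗₀ˢ(Ω)` of all `u ∈ L²(ℝⁿ)` (as classes modulo null sets) with
`(u(x) - u(y)) / |x - y|^{n/2 + s} ∈ L²(ℝⁿ × ℝⁿ)` and `u = 0` almost everywhere
outside `Ω`. -/
noncomputable def fracSobolevZero {n : ℕ} (s : ℝ) (Ω : Set (EuclideanSpace ℝ (Fin n))) :
    Submodule ℝ (Lp ℝ 2 (volume : Measure (EuclideanSpace ℝ (Fin n)))) where
  carrier := {u | MemLp (diffQuotient s u) 2 volume ∧ ∀ᵐ x, x ∉ Ω → u x = 0}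
  add_mem' := by
    rintro u v ⟨hu, hu0⟩ ⟨hv, hv0⟩
    refine ⟨?_, ?_⟩
    · have h := diffQuotient_congr s (Lp.coeFn_add u v)
      rw [diffQuotient_add] at h
      exact (memLp_congr_ae h).2 (hu.add hv)
    · filter_upwards [hu0, hv0, Lp.coeFn_add u v] with x h1 h2 h3 hx
      rw [h3, Pi.add_apply, h1 hx, h2 hx, add_zero]
  zero_mem' := by
    refine ⟨?_, ?_⟩
    · have h := diffQuotient_congr s
        (Lp.coeFn_zero ℝ 2 (volume : Measure (EuclideanSpace ℝ (Fin n))))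
      refine (memLp_congr_ae h).2 ?_
      have h0 : diffQuotient s (0 : EuclideanSpace ℝ (Fin n) → ℝ) = 0 := by
        funext p
        simp [diffQuotient]
      rw [h0]
      exact MemLp.zero
    · filter_upwards [Lp.coeFn_zero ℝ 2
        (volume : Measure (EuclideanSpace ℝ (Fin n)))] with x h _
      rw [h, Pi.zero_apply]
  smul_mem' := by
    rintro c u ⟨hu, hu0⟩
    refine ⟨?_, ?_⟩
    · have h := diffQuotient_congr s (Lp.coeFn_smul c u)
      rw [diffQuotient_smul] at h
      exact (memLp_congr_ae h).2 (hu.const_smul c)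
    · filter_upwards [hu0, Lp.coeFn_smul c u] with x h1 h3 hx
      rw [h3, Pi.smul_apply, h1 hx, smul_zero]

/-- The weak formulation of `(-Δ)^s φ = lam w φ` in `Ω`, `φ = 0` outside `Ω`:
`φ ∈ 𝓗₀ˢ(Ω)` and `𝓔_s(φ, v) = lam ∫_Ω w φ v` for all `v ∈ 𝓗₀ˢ(Ω)`. -/
def IsWeakEigenSolution {n : ℕ} (s : ℝ) (Ω : Set (EuclideanSpace ℝ (Fin n)))
    (w : EuclideanSpace ℝ (Fin n) → ℝ) (lam : ℝ)
    (φ : Lp ℝ 2 (volume : Measure (EuclideanSpace ℝ (Fin n)))) : Prop :=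
  φ ∈ fracSobolevZero s Ω ∧
    ∀ v ∈ fracSobolevZero s Ω, fracForm s φ v = lam * ∫ x in Ω, w x * φ x * v x

theorem fracForm_congr_left {n : ℕ} (s : ℝ) {u u' : EuclideanSpace ℝ (Fin n) → ℝ}
    (v : EuclideanSpace ℝ (Fin n) → ℝ) (h : u =ᵐ[volume] u') :
    fracForm s u v = fracForm s u' v := by
  rw [fracForm_eq_integral_diffQuotient, fracForm_eq_integral_diffQuotient]
  congr 1
  refine integral_congr_ae ?_
  filter_upwards [diffQuotient_congr s h] with p hp
  rw [hp]

theorem weighted_integrableOn {n : ℕ} {Ω : Set (EuclideanSpace ℝ (Fin n))}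
    (hΩ : Bornology.IsBounded Ω) (w : C(EuclideanSpace ℝ (Fin n), ℝ))
    (u v : Lp ℝ 2 (volume : Measure (EuclideanSpace ℝ (Fin n)))) :
    IntegrableOn (fun x => w x * u x * v x) Ω := by
  have h : Integrable (fun x => u x * v x) volume :=
    (Lp.memLp u).integrable_mul (Lp.memLp v)
  have h2 := (h.integrableOn (s := closure Ω)).continuousOn_mul
    w.continuous.continuousOn hΩ.isCompact_closure
  have h3 := h2.mono_set subset_closure
  simpa only [mul_assoc] using h3

/-- The eigenspace of the weighted problem with weight `w`: all its weak solutions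
(including `0`) for the parameter `lam`. -/
noncomputable def weightedEigenspace {n : ℕ} (s : ℝ) (Ω : Set (EuclideanSpace ℝ (Fin n)))
    (hΩ : Bornology.IsBounded Ω) (w : C(EuclideanSpace ℝ (Fin n), ℝ)) (lam : ℝ) :
    Submodule ℝ (Lp ℝ 2 (volume : Measure (EuclideanSpace ℝ (Fin n)))) where
  carrier := {φ | IsWeakEigenSolution s Ω w lam φ}
  add_mem' := by
    rintro φ ψ ⟨hφ, hφ'⟩ ⟨hψ, hψ'⟩
    refine ⟨add_mem hφ hψ, fun v hv => ?_⟩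
    have h1 : Integrable (fun p => diffQuotient s φ p * diffQuotient s v p) volume :=
      hφ.1.integrable_mul hv.1
    have h2 : Integrable (fun p => diffQuotient s ψ p * diffQuotient s v p) volume :=
      hψ.1.integrable_mul hv.1
    have hR : ∫ x in Ω, w x * (φ + ψ : Lp ℝ 2 volume) x * v x =
        (∫ x in Ω, w x * φ x * v x) + ∫ x in Ω, w x * ψ x * v x := by
      rw [← integral_add (weighted_integrableOn hΩ w φ v) (weighted_integrableOn hΩ w ψ v)]
      refine integral_congr_ae ?_
      filter_upwards [ae_restrict_of_ae (Lp.coeFn_add φ ψ)] with x hx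
      rw [hx, Pi.add_apply]
      ring
    rw [hR, mul_add, ← hφ' v hv, ← hψ' v hv, fracForm_congr_left s v (Lp.coeFn_add φ ψ)]
    simp only [fracForm_eq_integral_diffQuotient]
    rw [← mul_add, ← integral_add h1 h2]
    congr 2
    funext p
    rw [diffQuotient_add, Pi.add_apply, add_mul]
  zero_mem' := by
    refine ⟨zero_mem _, fun v _ => ?_⟩
    rw [fracForm_congr_left s v (Lp.coeFn_zero ℝ 2 volume)]
    have hR : ∫ x in Ω, w x * (0 : Lp ℝ 2 volume) x * v x = 0 := by
      rw [← integral_zero (EuclideanSpace ℝ (Fin n)) ℝ]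
      refine integral_congr_ae ?_
      filter_upwards [ae_restrict_of_ae (Lp.coeFn_zero ℝ 2
        (volume : Measure (EuclideanSpace ℝ (Fin n))))] with x hx
      rw [hx, Pi.zero_apply]
      ring
    rw [hR]
    simp [fracForm]
  smul_mem' := by
    rintro c φ ⟨hφ, hφ'⟩
    refine ⟨Submodule.smul_mem _ c hφ, fun v hv => ?_⟩
    have hR : ∫ x in Ω, w x * (c • φ : Lp ℝ 2 volume) x * v x =
        c * ∫ x in Ω, w x * φ x * v x := by
      rw [← integral_const_mul]
      refine integral_congr_ae ?_
      filter_upwards [ae_restrict_of_ae (Lp.coeFn_smul c φ)] with x hx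
      rw [hx, Pi.smul_apply, smul_eq_mul]
      ring
    rw [hR, mul_left_comm, ← hφ' v hv, fracForm_congr_left s v (Lp.coeFn_smul c φ)]
    simp only [fracForm_eq_integral_diffQuotient, diffQuotient_smul, Pi.smul_apply,
      smul_eq_mul, mul_assoc]
    rw [integral_const_mul]
    ring

/-- `lam` is an eigenvalue: the weighted problem has a weak solution `φ ≠ 0`. -/
def IsWeightedEigenvalue {n : ℕ} (s : ℝ) (Ω : Set (EuclideanSpace ℝ (Fin n)))
    (w : EuclideanSpace ℝ (Fin n) → ℝ) (lam : ℝ) : Prop :=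
  ∃ φ, φ ≠ 0 ∧ IsWeakEigenSolution s Ω w lam φ

/-!
The energy form makes `𝓗₀ˢ(Ω)` a Hilbert space: `u ↦ diffQuotient s u` identifies it with a closed
subspace `H` of `L²(ℝⁿ × ℝⁿ)` (`isClosed_range_diffQuotientL2`), and the inverse `J : H → L²(ℝⁿ)`
is bounded by a Poincaré inequality and compact. Compactness is seen by averaging over the cubes of
a grid of mesh `1 / N`: the averages span a finite-dimensional space and differ from `u` by at most
a constant times `N ^ (-s)` times the energy norm of `u` (`exists_step_function_approx`). For a
bounded continuous weight `w` the operator `T w = J† ∘ (multiplication by w) ∘ J` on `H` is compact,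
symmetric and *linear in the weight*, and a solution of the weighted problem with parameter `λ > 0`
is an eigenvector of `T w` with eigenvalue `C_{n,s} / (2 λ)`. It is therefore enough to find weights
arbitrarily near `α` for which all positive eigenvalues of `T w` are simple.

The Ky Fan sum `S_k(K)`, the supremum of `∑ ⟪K eᵢ, eᵢ⟫` over orthonormal `k`-frames, is Lipschitz in
`K`, and every frame `e` that attains it gives an affine function `w ↦ ∑ ⟪T w eᵢ, eᵢ⟫` which
supports `w ↦ S_k(T w)` from below. Where `S_k ∘ T` is differentiable in a direction `c`, or
merely has symmetric second difference `o(t)` along `c`, all maximizing frames thus have the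
same value of `∑ ⟪T c eᵢ, eᵢ⟫`. By Rademacher's theorem on lines and Baire's theorem this holds
for a dense set of weights, simultaneously for all `k` and all `c` in a given sequence
(`dense_setOf_forall_secondDiff_lt`).

At such a weight let `φ`, `ψ` be orthonormal eigenvectors for the same eigenvalue `μ > 0`. A frame
of eigenvectors for the finitely many eigenvalues above `μ`, completed by any unit eigenvector for
`μ`, maximizes its Ky Fan sum (`exists_maximal_frame`). Comparing the completions by `φ`, by `ψ` and
by `(3 φ + 4 ψ) / 5` gives `∫ c φ² = ∫ c ψ²` and `∫ c φ ψ = 0` for all `c` in the sequence. If the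
sequence is dense in `C(closure Ω)`, then `φ² = ψ²` and `φ ψ = 0` almost everywhere, so `φ = 0`, a
contradiction. No unique continuation property is needed.
-/

/-! ### Compact symmetric operators and Ky Fan sums -/

section Spectral

open scoped InnerProductSpace

variable {H : Type*} [NormedAddCommGroup H] [InnerProductSpace ℝ H]

/-- Diagonalization of a compact symmetric operator. The basis, indexed by itself, collects
Hilbert bases of all eigenspaces. -/
theorem exists_hilbertBasis_eigenvectors [CompleteSpace H] {K : H →L[ℝ] H}
    (hK : IsCompactOperator K) (hs : (K : H →ₗ[ℝ] H).IsSymmetric) :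
    ∃ (w : Set H) (b : HilbertBasis w ℝ H) (ν : w → ℝ), ∀ i, K (b i) = ν i • b i := by
  have hmem : ∀ μ x, x ∈ Module.End.eigenspace (K : Module.End ℝ H) μ ↔ K x = μ • x :=
    fun μ x => Module.End.mem_eigenspace_iff
  have hVc : ∀ μ, CompleteSpace (Module.End.eigenspace (K : Module.End ℝ H) μ) := fun μ => by
    have : IsClosed (Module.End.eigenspace (K : Module.End ℝ H) μ : Set H) := by
      have : (Module.End.eigenspace (K : Module.End ℝ H) μ : Set H) = {x | K x = μ • x} := by
        ext x; exact hmem μ x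
      rw [this]
      exact isClosed_eq K.continuous (continuous_const_smul μ)
    exact this.completeSpace_coe
  choose w b hb using fun μ => exists_hilbertBasis ℝ (Module.End.eigenspace (K : Module.End ℝ H) μ)
  obtain ⟨e, he⟩ : ∃ e : (Σ μ, w μ) → H, ∀ a, e a = (b a.1 a.2 : H) := ⟨_, fun _ => rfl⟩
  have horth : Orthonormal ℝ e := by
    have h := hs.orthogonalFamily_eigenspaces.orthonormal_sigma_orthonormal
      fun μ => (b μ).orthonormal
    have h' : e = fun a : Σ μ, w μ => (b a.1 a.2 : H) := funext he
    rw [h']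
    exact h
  have hbot : (Submodule.span ℝ (Set.range e))ᗮ = ⊥ := by
    rw [eq_bot_iff, ← ContinuousLinearMap.orthogonalComplement_iSup_eigenspaces_eq_bot hK hs]
    intro x hx
    rw [Submodule.mem_orthogonal'] at hx ⊢
    have hker : (⨆ μ, Module.End.eigenspace (K : Module.End ℝ H) μ) ≤
        LinearMap.ker (innerSL ℝ x : H →ₗ[ℝ] ℝ) := iSup_le fun μ => by
      have h1 : (Submodule.span ℝ (Set.range (b μ))).topologicalClosure ≤
          LinearMap.ker (((innerSL ℝ x).comp
            (Module.End.eigenspace (K : Module.End ℝ H) μ).subtypeL :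
              Module.End.eigenspace (K : Module.End ℝ H) μ →L[ℝ] ℝ) : _ →ₗ[ℝ] ℝ) := by
        refine Submodule.topologicalClosure_minimal _ (Submodule.span_le.2 ?_)
          (ContinuousLinearMap.isClosed_ker _)
        rintro _ ⟨i, rfl⟩
        have := hx (e ⟨μ, i⟩) (Submodule.subset_span ⟨_, rfl⟩)
        rw [he] at this
        exact this
      rw [(b μ).dense_span] at h1
      intro y hy
      exact h1 (Submodule.mem_top (x := ⟨y, hy⟩))
    intro y hy
    exact hker hy
  have heig : ∀ a, K (e a) = a.1 • e a := fun a => by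
    rw [he]
    exact (hmem _ _).1 (b a.1 a.2).2
  have heig' : ∀ x : Set.range e, ∃ ν : ℝ, K x = ν • (x : H) := by
    rintro ⟨_, a, rfl⟩
    exact ⟨_, heig a⟩
  choose ν hν using heig'
  refine ⟨Set.range e, HilbertBasis.mkOfOrthogonalEqBot horth.toSubtypeRange ?_, ν, fun i => ?_⟩
  · rw [Subtype.range_coe]
    exact hbot
  · rw [HilbertBasis.coe_mkOfOrthogonalEqBot]
    exact hν i

/-- The images of orthonormal eigenvectors with eigenvalues above `μ` are at mutual distance at
least `μ`, so compactness allows finitely many of them only. -/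
theorem finite_setOf_lt_eigenvalue {K : H →L[ℝ] H} (hK : IsCompactOperator K)
    {ι : Type*} {e : ι → H} (he : Orthonormal ℝ e) {ν : ι → ℝ}
    (hν : ∀ i, K (e i) = ν i • e i) {μ : ℝ} (hμ : 0 < μ) : {i | μ < ν i}.Finite := by
  by_contra hinf
  have hinf : {i | μ < ν i}.Infinite := hinf
  let g := hinf.natEmbedding
  have hc := hK.isCompact_closure_image_closedBall (f := (K : H →ₗ[ℝ] H)) 1
  obtain ⟨a, -, θ, hθ, hlim⟩ := hc.tendsto_subseq (x := fun j => K (e (g j))) fun j =>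
    subset_closure ⟨_, by simp [he.1], rfl⟩
  obtain ⟨N, hN⟩ := Metric.cauchySeq_iff'.1 hlim.cauchySeq μ hμ
  have h1 := hN (N + 1) (by omega)
  have hne : (g (θ (N + 1)) : ι) ≠ g (θ N) := fun h =>
    absurd (hθ.injective (g.injective (Subtype.ext h))) (by omega)
  have h2 := (g (θ (N + 1))).2
  simp only [Function.comp_apply, dist_eq_norm, hν] at h1
  simp only [Set.mem_ofPred_eq] at h2
  set i := (g (θ (N + 1)) : ι)
  set j := (g (θ N) : ι)
  have h3 : ⟪ν i • e i - ν j • e j, e i⟫_ℝ = ν i := by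
    rw [inner_sub_left, inner_smul_left, inner_smul_left, real_inner_self_eq_norm_sq, he.1,
      he.2 hne.symm]
    simp
  have h4 := real_inner_le_norm (ν i • e i - ν j • e j) (e i)
  rw [h3, he.1] at h4
  linarith

/-- Ky Fan's maximum principle at the level `μ`: eigenvectors `e` for the eigenvalues above `μ`,
completed by *any* unit eigenvector `φ` for `μ`, maximize `∑ ⟪K fᵢ, fᵢ⟫` among orthonormal frames of
the same length. The frame `e` does not depend on `φ`; it is empty if no eigenvalue exceeds `μ`. -/
theorem exists_maximal_frame [CompleteSpace H] {K : H →L[ℝ] H}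
    (hK : IsCompactOperator K) (hs : (K : H →ₗ[ℝ] H).IsSymmetric) {μ : ℝ} (hμ : 0 < μ) :
    ∃ (k : ℕ) (e : Fin k → H), ∀ φ : H, ‖φ‖ = 1 → K φ = μ • φ →
      Orthonormal ℝ (Fin.cons φ e : Fin (k + 1) → H) ∧
      ∀ f : Fin (k + 1) → H, Orthonormal ℝ f →
        ∑ i, ⟪K (f i), f i⟫_ℝ ≤
          ∑ i, ⟪K ((Fin.cons φ e : Fin (k + 1) → H) i), (Fin.cons φ e : Fin (k + 1) → H) i⟫_ℝ := by
  obtain ⟨ι, b, ν, hν⟩ := exists_hilbertBasis_eigenvectors hK hs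
  have hfin := finite_setOf_lt_eigenvalue hK b.orthonormal hν hμ
  let F := hfin.toFinset
  have hF : ∀ i, i ∈ F ↔ μ < ν i := fun i => by simp [F]
  let eqv := F.equivFin
  let r : Fin F.card → ι := fun j => eqv.symm j
  have hr : Function.Injective r := Subtype.val_injective.comp eqv.symm.injective
  have hrF : ∀ j, μ < ν (r j) := fun j => (hF _).1 (eqv.symm j).2
  have hsumF : ∀ g : ι → ℝ, ∑ j, g (r j) = ∑ i ∈ F, g i := fun g => by
    rw [← Finset.sum_coe_sort F, ← Equiv.sum_comp eqv.symm]
  refine ⟨F.card, fun j => b (r j), fun φ hφ1 hφ => ⟨?_, fun f hf => ?_⟩⟩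
  · have horth : ∀ j, ⟪φ, b (r j)⟫_ℝ = 0 := fun j => by
      have h := hs φ (b (r j))
      simp only [ContinuousLinearMap.coe_coe, hφ, hν, inner_smul_left, inner_smul_right,
        conj_trivial] at h
      have h' : (ν (r j) - μ) * ⟪φ, b (r j)⟫_ℝ = 0 := by linarith
      rcases mul_eq_zero.1 h' with h' | h'
      · linarith [hrF j]
      · exact h'
    have hb := b.orthonormal.comp r hr
    refine ⟨fun i => ?_, fun i j => ?_⟩
    · refine Fin.cases ?_ (fun i => ?_) i
      · simpa using hφ1
      · simpa using hb.1 i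
    · refine Fin.cases ?_ (fun i => ?_) i <;> refine Fin.cases ?_ (fun j => ?_) j
      · simp
      · intro _; simpa using horth j
      · intro _; simpa [real_inner_comm] using horth i
      · intro h; simpa using hb.2 (fun h' => h (by rw [h']))
  · -- Of `K - μ` only the diagonal entries in `F` are positive, and by Bessel's inequality the
    -- frame `f` gives each of them a total weight of at most one.
    have key : ∀ x : H, ⟪K x, x⟫_ℝ - μ * ‖x‖ ^ 2 ≤ ∑ i ∈ F, (ν i - μ) * ⟪b i, x⟫_ℝ ^ 2 := fun x => by
      have h1 := b.hasSum_inner_mul_inner (K x) x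
      have h2 := b.hasSum_inner_mul_inner x x
      have h3 : ∀ i, ⟪K x, b i⟫_ℝ = ν i * ⟪b i, x⟫_ℝ := fun i => by
        have h := hs x (b i)
        simp only [ContinuousLinearMap.coe_coe, hν, inner_smul_right] at h
        rw [h, real_inner_comm]
      simp only [h3] at h1
      have h4 := (h2.mul_left μ).sub h1
      have h5 := sum_le_hasSum F (fun i hi => ?_) h4
      · rw [real_inner_self_eq_norm_sq] at h5
        have : ∑ i ∈ F, (μ * (⟪x, b i⟫_ℝ * ⟪b i, x⟫_ℝ) - ν i * ⟪b i, x⟫_ℝ * ⟪b i, x⟫_ℝ) =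
            - ∑ i ∈ F, (ν i - μ) * ⟪b i, x⟫_ℝ ^ 2 := by
          rw [← Finset.sum_neg_distrib]
          refine Finset.sum_congr rfl fun i _ => ?_
          rw [real_inner_comm x (b i)]
          ring
        linarith
      · rw [hF, not_lt] at hi
        rw [real_inner_comm (b i) x]
        nlinarith [sq_nonneg ⟪b i, x⟫_ℝ]
    have hle : ∑ i, (⟪K (f i), f i⟫_ℝ - μ * ‖f i‖ ^ 2) ≤ ∑ i ∈ F, (ν i - μ) := by
      calc _ ≤ ∑ j, ∑ i ∈ F, (ν i - μ) * ⟪b i, f j⟫_ℝ ^ 2 := Finset.sum_le_sum fun j _ => key _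
        _ = ∑ i ∈ F, (ν i - μ) * ∑ j, ⟪b i, f j⟫_ℝ ^ 2 := by
          rw [Finset.sum_comm]
          simp only [Finset.mul_sum]
        _ ≤ _ := Finset.sum_le_sum fun i hi => by
          have h1 := hf.sum_inner_products_le (b i) (s := Finset.univ)
          rw [b.orthonormal.1] at h1
          have h2 := (hF i).1 hi
          have h3 : ∑ j, ⟪b i, f j⟫_ℝ ^ 2 ≤ 1 := by
            simpa [real_inner_comm] using h1
          nlinarith
    have hKb : ∀ j, ⟪K (b (r j)), b (r j)⟫_ℝ = ν (r j) := fun j => by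
      rw [hν, inner_smul_left, real_inner_self_eq_norm_sq, b.orthonormal.1]
      simp
    have hKφ : ⟪K φ, φ⟫_ℝ = μ := by
      rw [hφ, inner_smul_left, real_inner_self_eq_norm_sq, hφ1]
      simp
    have hcons : ∑ i, ⟪K ((Fin.cons φ fun j => b (r j) : Fin (F.card + 1) → H) i),
        (Fin.cons φ fun j => b (r j) : Fin (F.card + 1) → H) i⟫_ℝ = μ + ∑ i ∈ F, ν i := by
      rw [Fin.sum_univ_succ, ← hsumF ν]
      simp only [Fin.cons_zero, Fin.cons_succ, hKb, hKφ]
    rw [hcons]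
    simp only [hf.1, Finset.sum_sub_distrib, Finset.sum_const, Finset.card_univ, Fintype.card_fin,
      nsmul_eq_mul] at hle
    push_cast at hle
    linarith

/-- The Ky Fan sum: the supremum of `∑ ⟪K eᵢ, eᵢ⟫` over orthonormal `k`-frames `e`, that is, the sum
of the `k` largest eigenvalues in the compact, positive, infinite-dimensional case. It is `0` if
there is no orthonormal `k`-frame. -/
noncomputable def kyFanSum (k : ℕ) (K : H →L[ℝ] H) : ℝ :=
  ⨆ e : {e : Fin k → H // Orthonormal ℝ e}, ∑ i, ⟪K (e.1 i), e.1 i⟫_ℝ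

theorem sum_inner_le_of_orthonormal {k : ℕ} (K : H →L[ℝ] H) {e : Fin k → H}
    (he : Orthonormal ℝ e) : ∑ i, ⟪K (e i), e i⟫_ℝ ≤ k * ‖K‖ := by
  calc _ ≤ ∑ _i : Fin k, ‖K‖ := Finset.sum_le_sum fun i _ => by
        have h1 := real_inner_le_norm (K (e i)) (e i)
        have h2 := K.le_opNorm (e i)
        rw [he.1] at h1 h2
        linarith
    _ = _ := by simp

theorem sum_inner_le_kyFanSum {k : ℕ} (K : H →L[ℝ] H) {e : Fin k → H}
    (he : Orthonormal ℝ e) : ∑ i, ⟪K (e i), e i⟫_ℝ ≤ kyFanSum k K := by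
  refine le_ciSup (f := fun e : {e : Fin k → H // Orthonormal ℝ e} =>
    ∑ i, ⟪K (e.1 i), e.1 i⟫_ℝ) ⟨k * ‖K‖, ?_⟩ ⟨e, he⟩
  rintro _ ⟨e, rfl⟩
  exact sum_inner_le_of_orthonormal K e.2

theorem lipschitzWith_kyFanSum (k : ℕ) : LipschitzWith k (kyFanSum k : (H →L[ℝ] H) → ℝ) := by
  refine LipschitzWith.of_le_add_mul _ fun K K' => ?_
  -- Without frames both suprema are `0` by convention.
  rcases isEmpty_or_nonempty {e : Fin k → H // Orthonormal ℝ e} with h | h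
  · simp only [kyFanSum, Real.iSup_of_isEmpty]
    positivity
  · refine ciSup_le fun e => ?_
    have h1 := sum_inner_le_of_orthonormal (K - K') e.2
    have h2 := sum_inner_le_kyFanSum K' e.2
    simp only [sub_apply, inner_sub_left, Finset.sum_sub_distrib] at h1
    rw [dist_eq_norm]
    push_cast
    linarith

end Spectral

/-! ### Generic simplicity in linear families of operators -/

section Genericity

open scoped InnerProductSpace NNReal Topology

variable {X : Type*} [NormedAddCommGroup X] [NormedSpace ℝ X]

theorem isOpen_setOf_secondDiff_lt {f : X → ℝ} (hf : Continuous f) (c : X) (η : ℝ) :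
    IsOpen {b | ∃ t > 0, f (b + t • c) + f (b - t • c) - 2 * f b < η * t} := by
  have : {b | ∃ t > 0, f (b + t • c) + f (b - t • c) - 2 * f b < η * t} =
      ⋃ t ∈ Set.Ioi (0 : ℝ), {b | f (b + t • c) + f (b - t • c) - 2 * f b < η * t} := by
    ext b
    simp
  rw [this]
  exact isOpen_biUnion fun t _ => isOpen_lt (by fun_prop) continuous_const

/-- A Lipschitz function is differentiable almost everywhere on each line, and its symmetric
second difference is `o(t)` where it is differentiable. -/
theorem dense_setOf_secondDiff_lt {f : X → ℝ} {L : ℝ≥0} (hf : LipschitzWith L f) (c : X)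
    {η : ℝ} (hη : 0 < η) :
    Dense {b | ∃ t > 0, f (b + t • c) + f (b - t • c) - 2 * f b < η * t} := by
  intro b
  have hline : LipschitzWith (L * ‖c‖₊) fun r : ℝ => f (b + r • c) := by
    refine hf.comp (LipschitzWith.of_dist_le_mul fun r r' => ?_)
    rw [dist_eq_norm, dist_eq_norm, add_sub_add_left_eq_sub, ← sub_smul, norm_smul, mul_comm,
      coe_nnnorm]
  have hdense : Dense {r : ℝ | DifferentiableAt ℝ (fun r : ℝ => f (b + r • c)) r} :=
    Measure.dense_of_ae hline.ae_differentiableAt_real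
  have hsub : ∀ r : ℝ, DifferentiableAt ℝ (fun r : ℝ => f (b + r • c)) r → b + r • c ∈
      {b | ∃ t > 0, f (b + t • c) + f (b - t • c) - 2 * f b < η * t} := by
    intro r hr
    have h := hasDerivAt_iff_isLittleO_nhds_zero.1 hr.hasDerivAt
    have h1 := h.def (c := η / 4) (by positivity)
    have h2 : ∀ᶠ t : ℝ in 𝓝 0, ‖f (b + (r + -t) • c) - f (b + r • c) -
        (-t) • deriv (fun r : ℝ => f (b + r • c)) r‖ ≤ η / 4 * ‖-t‖ := by
      have : Filter.Tendsto (fun t : ℝ => -t) (𝓝 0) (𝓝 0) := by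
        simpa using (continuous_neg (G := ℝ)).tendsto 0
      exact this.eventually h1
    obtain ⟨t, ⟨ht1, ht2⟩, ht0⟩ := (((h1.and h2).filter_mono nhdsWithin_le_nhds).and
      (self_mem_nhdsWithin : Set.Ioi (0 : ℝ) ∈ 𝓝[>] 0)).exists
    refine ⟨t, ht0, ?_⟩
    have ht0 : 0 < t := ht0
    simp only [Real.norm_eq_abs, abs_neg, abs_of_pos ht0, smul_eq_mul] at ht1 ht2
    have e1 : b + r • c + t • c = b + (r + t) • c := by module
    have e2 : b + r • c - t • c = b + (r + -t) • c := by module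
    rw [e1, e2]
    have := abs_le.1 ht1
    have := abs_le.1 ht2
    nlinarith
  have hcont : Continuous fun r : ℝ => b + r • c := by fun_prop
  have h0 := hcont.range_subset_closure_image_dense hdense (Set.mem_range_self 0)
  simp only [zero_smul, add_zero] at h0
  refine closure_mono ?_ h0
  rintro _ ⟨r, hr, rfl⟩
  exact hsub r hr

/-- Baire's theorem, applied to the dense open sets belonging to all `k`, `j` and `η = 1 / (m + 1)`. -/
theorem dense_setOf_forall_secondDiff_lt [CompleteSpace X] {f : ℕ → X → ℝ}
    (hf : ∀ k, ∃ L, LipschitzWith L (f k)) (c : ℕ → X) :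
    Dense {b | ∀ k j, ∀ η > 0, ∃ t > 0,
      f k (b + t • c j) + f k (b - t • c j) - 2 * f k b < η * t} := by
  have h := dense_iInter_of_isOpen (X := X) (ι := ℕ × ℕ × ℕ)
    (f := fun q => {b | ∃ t > 0, f q.1 (b + t • c q.2.1) + f q.1 (b - t • c q.2.1) -
      2 * f q.1 b < (1 / ((q.2.2 : ℝ) + 1)) * t})
    (fun q => isOpen_setOf_secondDiff_lt (hf q.1).choose_spec.continuous _ _)
    (fun q => dense_setOf_secondDiff_lt (hf q.1).choose_spec _ (by positivity))
  refine h.mono fun b hb k j η hη => ?_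
  obtain ⟨m, hm⟩ := exists_nat_one_div_lt hη
  obtain ⟨t, ht, hlt⟩ := Set.mem_iInter.1 hb (k, j, m)
  exact ⟨t, ht, hlt.trans (by gcongr)⟩

variable {H : Type*} [NormedAddCommGroup H] [InnerProductSpace ℝ H]

/-- Frames `e`, `e'` attaining `kyFanSum k (T b)` bound it below by affine functions on both sides of
`b`; a small second difference along `c` forces their slopes to agree. Stated as an inequality, to be
used with `e` and `e'` exchanged as well. -/
theorem sum_inner_le_of_secondDiff_lt (T : X →L[ℝ] H →L[ℝ] H) {k : ℕ} {b c : X}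
    (hb : ∀ η > 0, ∃ t > 0, kyFanSum k (T (b + t • c)) + kyFanSum k (T (b - t • c)) -
      2 * kyFanSum k (T b) < η * t) {e e' : Fin k → H} (he : Orthonormal ℝ e)
    (he' : Orthonormal ℝ e') (hmax : kyFanSum k (T b) ≤ ∑ i, ⟪T b (e i), e i⟫_ℝ)
    (hmax' : kyFanSum k (T b) ≤ ∑ i, ⟪T b (e' i), e' i⟫_ℝ) :
    ∑ i, ⟪T c (e i), e i⟫_ℝ ≤ ∑ i, ⟪T c (e' i), e' i⟫_ℝ := by
  refine le_of_forall_pos_le_add fun η hη => ?_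
  obtain ⟨t, ht, hlt⟩ := hb η hη
  have h1 := sum_inner_le_kyFanSum (T (b + t • c)) he
  have h2 := sum_inner_le_kyFanSum (T (b - t • c)) he'
  simp only [map_add, map_sub, map_smul, add_apply, sub_apply, smul_apply, inner_add_left,
    inner_sub_left, real_inner_smul_left, Finset.sum_add_distrib, Finset.sum_sub_distrib,
    ← Finset.mul_sum] at h1 h2 hlt
  have h3 : t * ∑ i, ⟪T c (e i), e i⟫_ℝ ≤ t * (∑ i, ⟪T c (e' i), e' i⟫_ℝ + η) := by
    linarith
  exact le_of_mul_le_mul_left h3 ht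

/-- For a linear family of compact symmetric operators that separates orthonormal pairs in the sense
of `hsep`, the positive eigenvalues are generically simple: no two orthonormal eigenvectors belong to the
same eigenvalue. -/
theorem dense_setOf_simple_eigenvalues [CompleteSpace X] [CompleteSpace H]
    (T : X →L[ℝ] H →L[ℝ] H) (hK : ∀ b, IsCompactOperator (T b))
    (hs : ∀ b, (T b : H →ₗ[ℝ] H).IsSymmetric) (c : ℕ → X)
    (hsep : ∀ φ ψ : H, (∀ j, ⟪T (c j) φ, φ⟫_ℝ = ⟪T (c j) ψ, ψ⟫_ℝ) →
      (∀ j, ⟪T (c j) φ, ψ⟫_ℝ = 0) → φ = 0) :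
    Dense {b | ∀ μ : ℝ, 0 < μ → ∀ φ ψ : H, T b φ = μ • φ → T b ψ = μ • ψ → ‖φ‖ = 1 → ‖ψ‖ = 1 →
      ⟪φ, ψ⟫_ℝ ≠ 0} := by
  refine (dense_setOf_forall_secondDiff_lt (f := fun k b => kyFanSum k (T b))
    (fun k => ⟨_, (lipschitzWith_kyFanSum k).comp T.lipschitz⟩) c).mono ?_
  intro b hb μ hμ φ ψ hφ hψ hφ1 hψ1 horth
  obtain ⟨k, e, he⟩ := exists_maximal_frame (hK b) (hs b) hμ
  have hne : Nonempty {f : Fin (k + 1) → H // Orthonormal ℝ f} := ⟨_, (he φ hφ1 hφ).1⟩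
  have hmax : ∀ χ, ‖χ‖ = 1 → T b χ = μ • χ → kyFanSum (k + 1) (T b) ≤
      ∑ i, ⟪T b ((Fin.cons χ e : Fin (k + 1) → H) i), (Fin.cons χ e : Fin (k + 1) → H) i⟫_ℝ :=
    fun χ hχ1 hχ => ciSup_le fun f => (he χ hχ1 hχ).2 f.1 f.2
  have hle : ∀ j χ χ', ‖χ‖ = 1 → T b χ = μ • χ → ‖χ'‖ = 1 → T b χ' = μ • χ' →
      ⟪T (c j) χ, χ⟫_ℝ ≤ ⟪T (c j) χ', χ'⟫_ℝ := fun j χ χ' h1 h2 h3 h4 => by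
    have h := sum_inner_le_of_secondDiff_lt T (hb (k + 1) j) (he χ h1 h2).1 (he χ' h3 h4).1
      (hmax χ h1 h2) (hmax χ' h3 h4)
    simpa [Fin.sum_univ_succ] using h
  have heq : ∀ j χ χ', ‖χ‖ = 1 → T b χ = μ • χ → ‖χ'‖ = 1 → T b χ' = μ • χ' →
      ⟪T (c j) χ, χ⟫_ℝ = ⟪T (c j) χ', χ'⟫_ℝ := fun j χ χ' h1 h2 h3 h4 =>
    le_antisymm (hle j χ χ' h1 h2 h3 h4) (hle j χ' χ h3 h4 h1 h2)
  have hφ0 : φ = 0 := by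
    refine hsep φ ψ (fun j => heq j φ ψ hφ1 hφ hψ1 hψ) fun j => ?_
    -- The coefficients are a rational point on the unit circle, so this is a unit eigenvector;
    -- its quadratic form brings in the mixed term `⟪T (c j) φ, ψ⟫`.
    have h1 : ‖(3 / 5 : ℝ) • φ + (4 / 5 : ℝ) • ψ‖ = 1 := by
      have : ‖(3 / 5 : ℝ) • φ + (4 / 5 : ℝ) • ψ‖ ^ 2 = 1 := by
        rw [norm_add_sq_real, norm_smul, norm_smul, real_inner_smul_left, real_inner_smul_right,
          horth, hφ1, hψ1]
        norm_num
      exact (sq_eq_sq₀ (norm_nonneg _) zero_le_one).1 (by rw [this, one_pow])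
    have h2 : T b ((3 / 5 : ℝ) • φ + (4 / 5 : ℝ) • ψ) =
        μ • ((3 / 5 : ℝ) • φ + (4 / 5 : ℝ) • ψ) := by
      rw [map_add, map_smul, map_smul, hφ, hψ]
      module
    have h3 := heq j φ _ hφ1 hφ h1 h2
    have h4 := heq j φ ψ hφ1 hφ hψ1 hψ
    have h5 : ⟪T (c j) ψ, φ⟫_ℝ = ⟪T (c j) φ, ψ⟫_ℝ := by
      have := hs (c j) ψ φ
      rw [ContinuousLinearMap.coe_coe] at this
      rw [this, real_inner_comm]
    simp only [map_add, map_smul, inner_add_left, inner_add_right, real_inner_smul_left,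
      real_inner_smul_right, h5, ← h4] at h3
    linarith
  rw [hφ0, norm_zero] at hφ1
  exact zero_ne_one hφ1

end Genericity

/-! ### Estimates for the fractional difference quotient -/

section Estimates

variable {n : ℕ} {s : ℝ}

theorem sq_sub_le_rpow_mul_sq_diffQuotient (hs : 0 < s) (u : EuclideanSpace ℝ (Fin n) → ℝ)
    {d : ℝ} {p : EuclideanSpace ℝ (Fin n) × EuclideanSpace ℝ (Fin n)} (hp : ‖p.1 - p.2‖ ≤ d) :
    (u p.1 - u p.2) ^ 2 ≤ d ^ ((n : ℝ) + 2 * s) * diffQuotient s u p ^ 2 := by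
  rcases eq_or_ne p.1 p.2 with h | h
  · rw [h, sub_self, zero_pow two_ne_zero]
    have : 0 ≤ d := (norm_nonneg _).trans hp
    positivity
  · have hr : 0 < ‖p.1 - p.2‖ := norm_pos_iff.2 (sub_ne_zero.2 h)
    have h1 : (u p.1 - u p.2) ^ 2 =
        ‖p.1 - p.2‖ ^ ((n : ℝ) + 2 * s) * diffQuotient s u p ^ 2 := by
      have h2 : ‖p.1 - p.2‖ ^ ((n : ℝ) + 2 * s) = (‖p.1 - p.2‖ ^ ((n : ℝ) / 2 + s)) ^ 2 := by
        rw [← Real.rpow_mul_natCast hr.le]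
        congr 1
        push_cast
        ring
      have h3 : ‖p.1 - p.2‖ ^ ((n : ℝ) / 2 + s) ≠ 0 := (Real.rpow_pos_of_pos hr _).ne'
      rw [h2, diffQuotient]
      field_simp
    rw [h1]
    gcongr

theorem setIntegral_sq_sub_le (hs : 0 < s) {u : EuclideanSpace ℝ (Fin n) → ℝ}
    (hu : MemLp (diffQuotient s u) 2 volume) {d : ℝ}
    {A : Set (EuclideanSpace ℝ (Fin n) × EuclideanSpace ℝ (Fin n))} (hA : MeasurableSet A)
    (hd : ∀ p ∈ A, ‖p.1 - p.2‖ ≤ d) :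
    ∫ p in A, (u p.1 - u p.2) ^ 2 ≤
      d ^ ((n : ℝ) + 2 * s) * ∫ p in A, diffQuotient s u p ^ 2 := by
  rw [← integral_const_mul]
  refine integral_mono_of_nonneg (Filter.Eventually.of_forall fun p => sq_nonneg _)
    (hu.integrable_sq.integrableOn.const_mul _) ?_
  filter_upwards [ae_restrict_mem hA] with p hp
  exact sq_sub_le_rpow_mul_sq_diffQuotient hs u (hd p hp)

/-- Fractional Poincaré inequality. On `Ω × B`, where `B` is a unit ball disjoint from `Ω`, the
difference `u(x) - u(y)` is `u(x)` and `|x - y|` is bounded. This is where `1 ≤ n` enters: in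
dimension zero there is no room for `B`. -/
theorem exists_integral_sq_le_integral_sq_diffQuotient (hn : 1 ≤ n) (hs : 0 < s)
    {Ω : Set (EuclideanSpace ℝ (Fin n))} (hΩm : MeasurableSet Ω) (hΩ : Bornology.IsBounded Ω) :
    ∃ C : ℝ, 0 ≤ C ∧ ∀ u ∈ fracSobolevZero s Ω,
      ∫ x, u x ^ 2 ≤ C * ∫ p, diffQuotient s u p ^ 2 := by
  obtain ⟨R, hR⟩ := hΩ.subset_closedBall 0
  have : Nontrivial (EuclideanSpace ℝ (Fin n)) := by
    have : Nonempty (Fin n) := ⟨⟨0, hn⟩⟩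
    infer_instance
  obtain ⟨y, hy⟩ := NormedSpace.exists_lt_norm ℝ (EuclideanSpace ℝ (Fin n)) (R + 1)
  set B := Metric.closedBall y 1
  have hBm : MeasurableSet B := Metric.isClosed_closedBall.measurableSet
  have hB0 : 0 < volume.real B :=
    ENNReal.toReal_pos (Metric.measure_closedBall_pos volume y one_pos).ne'
      measure_closedBall_lt_top.ne
  have hdisj : ∀ x ∈ B, x ∉ Ω := fun x hx hxΩ => by
    have h1 := hR hxΩ
    rw [mem_closedBall_zero_iff] at h1
    have h2 : ‖x - y‖ ≤ 1 := mem_closedBall_iff_norm.1 hx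
    have h3 := norm_sub_norm_le y x
    rw [norm_sub_rev] at h3
    linarith
  set d := R + (‖y‖ + 1)
  have hd : ∀ p ∈ Ω ×ˢ B, ‖p.1 - p.2‖ ≤ d := fun p hp => by
    have h1 := hR hp.1
    rw [mem_closedBall_zero_iff] at h1
    have h2 : ‖p.2 - y‖ ≤ 1 := mem_closedBall_iff_norm.1 hp.2
    have h3 := norm_sub_le p.1 p.2
    have h4 := norm_sub_norm_le p.2 y
    simp only [d]
    linarith
  refine ⟨(volume.real B)⁻¹ * |d ^ ((n : ℝ) + 2 * s)|, by positivity, fun u hu => ?_⟩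
  have h1 := setIntegral_sq_sub_le hs hu.1 (hΩm.prod hBm) hd
  have h2 : ∫ p in Ω ×ˢ B, (u p.1 - u p.2) ^ 2 = ∫ p in Ω ×ˢ B, u p.1 ^ 2 * 1 := by
    refine setIntegral_congr_ae (hΩm.prod hBm) ?_
    have := (Measure.quasiMeasurePreserving_snd (μ := (volume : Measure (EuclideanSpace ℝ (Fin n))))
      (ν := (volume : Measure (EuclideanSpace ℝ (Fin n))))).ae hu.2
    rw [Measure.volume_eq_prod]
    filter_upwards [this] with p hp hpm
    rw [hp (hdisj _ hpm.2), sub_zero, mul_one]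
  have h3 : ∫ p in Ω ×ˢ B, u p.1 ^ 2 * 1 = (∫ x in Ω, u x ^ 2) * volume.real B := by
    have := setIntegral_prod_mul (μ := (volume : Measure (EuclideanSpace ℝ (Fin n))))
      (ν := (volume : Measure (EuclideanSpace ℝ (Fin n)))) (fun x => u x ^ 2) (fun _ => (1 : ℝ)) Ω B
    rw [Measure.volume_eq_prod, this]
    simp
  have h4 : ∫ x in Ω, u x ^ 2 = ∫ x, u x ^ 2 := by
    refine setIntegral_eq_integral_of_ae_compl_eq_zero ?_
    filter_upwards [hu.2] with x hx hxΩ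
    rw [hx hxΩ, zero_pow two_ne_zero]
  have h5 : ∫ p in Ω ×ˢ B, diffQuotient s u p ^ 2 ≤ ∫ p, diffQuotient s u p ^ 2 :=
    setIntegral_le_integral hu.1.integrable_sq (Filter.Eventually.of_forall fun p => sq_nonneg _)
  rw [h2, h3, h4] at h1
  rw [mul_assoc, inv_mul_eq_div, le_div_iff₀ hB0]
  refine h1.trans (mul_le_mul (le_abs_self _) h5 ?_ (abs_nonneg _))
  exact integral_nonneg fun p => sq_nonneg _

/-- The variance is bounded by (in fact it is half of) the mean square difference of two independent
samples. -/
theorem integral_sq_sub_average_le {α : Type*} [MeasurableSpace α] (μ : Measure α)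
    [IsFiniteMeasure μ] {u : α → ℝ} (hu : MemLp u 2 μ) (hμ : 0 < μ.real Set.univ) :
    ∫ x, (u x - (μ.real Set.univ)⁻¹ * ∫ y, u y ∂μ) ^ 2 ∂μ ≤
      (μ.real Set.univ)⁻¹ * ∫ p : α × α, (u p.1 - u p.2) ^ 2 ∂μ.prod μ := by
  set m := μ.real Set.univ with hm
  set a := ∫ y, u y ∂μ with ha
  have hu1 : Integrable u μ := hu.integrable one_le_two
  have hu2 : Integrable (fun x => u x ^ 2) μ := hu.integrable_sq
  have e1 : ∫ x, (u x - m⁻¹ * a) ^ 2 ∂μ = (∫ x, u x ^ 2 ∂μ) - m⁻¹ * a ^ 2 := by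
    have h : (fun x => (u x - m⁻¹ * a) ^ 2) =
        fun x => u x ^ 2 - (2 * (m⁻¹ * a)) * u x + (m⁻¹ * a) ^ 2 := by
      funext x; ring
    have i : Integrable (fun x => u x ^ 2 - (2 * (m⁻¹ * a)) * u x) μ := hu2.sub (hu1.const_mul _)
    rw [h, integral_add i (integrable_const _), integral_sub hu2 (hu1.const_mul _),
      integral_const_mul, integral_const, ← ha, ← hm,
      smul_eq_mul]
    field_simp
    ring
  have e2 : ∫ p : α × α, (u p.1 - u p.2) ^ 2 ∂μ.prod μ =
      2 * (m * ∫ x, u x ^ 2 ∂μ) - 2 * a ^ 2 := by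
    have h : (fun p : α × α => (u p.1 - u p.2) ^ 2) =
        fun p => u p.1 ^ 2 * 1 - 2 * (u p.1 * u p.2) + 1 * u p.2 ^ 2 := by
      funext p; ring
    have i1 : Integrable (fun p : α × α => u p.1 ^ 2 * 1) (μ.prod μ) :=
      hu2.mul_prod (integrable_const (1 : ℝ))
    have i2 : Integrable (fun p : α × α => u p.1 * u p.2) (μ.prod μ) := hu1.mul_prod hu1
    have i3 : Integrable (fun p : α × α => 1 * u p.2 ^ 2) (μ.prod μ) :=
      (integrable_const (1 : ℝ)).mul_prod hu2
    have i4 : Integrable (fun p : α × α => u p.1 ^ 2 * 1 - 2 * (u p.1 * u p.2)) (μ.prod μ) :=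
      i1.sub (i2.const_mul 2)
    rw [h, integral_add i4 i3, integral_sub i1 (i2.const_mul 2),
      integral_const_mul, integral_prod_mul (fun x => u x ^ 2) (fun _ => (1 : ℝ)),
      integral_prod_mul u u, integral_prod_mul (fun _ => (1 : ℝ)) (fun x => u x ^ 2),
      integral_const, ← ha, ← hm, smul_eq_mul]
    ring
  have e3 : 0 ≤ ∫ x, (u x - m⁻¹ * a) ^ 2 ∂μ := integral_nonneg fun x => sq_nonneg _
  rw [e2]
  have : m⁻¹ * (2 * (m * ∫ x, u x ^ 2 ∂μ) - 2 * a ^ 2) =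
      2 * ((∫ x, u x ^ 2 ∂μ) - m⁻¹ * a ^ 2) := by field_simp
  rw [this]
  linarith

end Estimates

/-! ### Cubes of a grid -/

section Cubes

variable {n : ℕ}

/-- The half-open cube of side `1 / N` with lower corner `k / N`, described as a fibre of
`x ↦ ⌊N x⌋`. -/
def gridCube (N : ℕ) (k : Fin n → ℤ) : Set (EuclideanSpace ℝ (Fin n)) :=
  {x | ∀ i, ⌊(N : ℝ) * x i⌋ = k i}

theorem measurableSet_gridCube (N : ℕ) (k : Fin n → ℤ) : MeasurableSet (gridCube N k) := by
  have : gridCube N k = ⋂ i, {x : EuclideanSpace ℝ (Fin n) | ⌊(N : ℝ) * x i⌋ = k i} := by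
    ext x; simp [gridCube]
  rw [this]
  refine MeasurableSet.iInter fun i => ?_
  have hm : Measurable fun x : EuclideanSpace ℝ (Fin n) => ⌊(N : ℝ) * x i⌋ :=
    Int.measurable_floor.comp (Continuous.measurable (by fun_prop))
  exact hm (measurableSet_singleton _)

theorem volume_gridCube {N : ℕ} (hN : 0 < N) (k : Fin n → ℤ) :
    volume (gridCube N k) = ENNReal.ofReal ((N : ℝ)⁻¹ ^ n) := by
  have hN' : (0 : ℝ) < N := Nat.cast_pos.2 hN
  have h : gridCube N k = (fun x : EuclideanSpace ℝ (Fin n) => WithLp.ofLp x) ⁻¹'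
      Set.univ.pi fun i => Set.Ico ((k i : ℝ) / N) ((k i + 1 : ℝ) / N) := by
    ext x
    simp only [gridCube, Set.mem_ofPred_eq, Set.mem_preimage, Set.mem_pi, Set.mem_univ,
      forall_const, Set.mem_Ico, Int.floor_eq_iff, div_le_iff₀ hN', lt_div_iff₀ hN', mul_comm]
  rw [h, (PiLp.volume_preserving_ofLp (Fin n)).measure_preimage
    (MeasurableSet.univ_pi fun i => measurableSet_Ico).nullMeasurableSet, volume_pi_pi]
  have h2 : ∀ i, volume (Set.Ico ((k i : ℝ) / N) ((k i + 1 : ℝ) / N)) =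
      ENNReal.ofReal ((N : ℝ)⁻¹) := fun i => by
    rw [Real.volume_Ico]
    congr 1
    field_simp
    ring
  simp only [h2, Finset.prod_const, Finset.card_univ, Fintype.card_fin]
  rw [ENNReal.ofReal_pow (by positivity)]

theorem norm_sub_le_of_mem_gridCube {N : ℕ} (hN : 0 < N) {k : Fin n → ℤ}
    {x y : EuclideanSpace ℝ (Fin n)} (hx : x ∈ gridCube N k) (hy : y ∈ gridCube N k) :
    ‖x - y‖ ≤ √n / N := by
  have hN' : (0 : ℝ) < N := Nat.cast_pos.2 hN
  have h : ∀ i, (x i - y i) ^ 2 ≤ ((N : ℝ)⁻¹) ^ 2 := fun i => by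
    have h1 := Int.floor_eq_iff.1 (hx i)
    have h2 := Int.floor_eq_iff.1 (hy i)
    refine sq_le_sq' ?_ ?_ <;> rw [← mul_le_mul_iff_right₀ hN'] <;> field_simp <;> nlinarith
  rw [EuclideanSpace.norm_eq]
  refine Real.sqrt_le_iff.2 ⟨by positivity, ?_⟩
  calc ∑ i, ‖(x - y) i‖ ^ 2 ≤ ∑ _i : Fin n, ((N : ℝ)⁻¹) ^ 2 :=
        Finset.sum_le_sum fun i _ => by simpa using h i
    _ = (√n / N) ^ 2 := by
        rw [div_pow, Real.sq_sqrt (Nat.cast_nonneg n)]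
        simp [div_eq_mul_inv]

theorem pairwise_disjoint_gridCube (N : ℕ) :
    Pairwise (Function.onFun Disjoint (gridCube (n := n) N)) := fun _ _ hkl =>
  Set.disjoint_left.2 fun _ hk hl => hkl (funext fun i => (hk i).symm.trans (hl i))

theorem exists_finset_subset_iUnion_gridCube {Ω : Set (EuclideanSpace ℝ (Fin n))}
    (hΩ : Bornology.IsBounded Ω) (N : ℕ) :
    ∃ F : Finset (Fin n → ℤ), Ω ⊆ ⋃ k ∈ F, gridCube N k := by
  obtain ⟨R, hR⟩ := hΩ.subset_closedBall 0
  refine ⟨Finset.Icc (fun _ => ⌊-((N : ℝ) * R)⌋) (fun _ => ⌊(N : ℝ) * R⌋), fun x hx => ?_⟩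
  have h1 := hR hx
  rw [mem_closedBall_zero_iff] at h1
  have h2 : ∀ i, |x i| ≤ R := fun i => (PiLp.norm_apply_le x i).trans h1
  refine Set.mem_biUnion (x := fun i => ⌊(N : ℝ) * x i⌋) ?_ (fun i => rfl)
  have h3 : ∀ i, -R ≤ x i ∧ x i ≤ R := fun i => abs_le.1 (h2 i)
  simp only [Finset.coe_Icc, Set.mem_Icc, Pi.le_def]
  refine ⟨fun i => Int.floor_mono ?_, fun i => Int.floor_mono ?_⟩
  · rw [← mul_neg]
    exact mul_le_mul_of_nonneg_left (h3 i).1 (Nat.cast_nonneg N)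
  · exact mul_le_mul_of_nonneg_left (h3 i).2 (Nat.cast_nonneg N)

end Cubes

/-! ### Approximation by step functions -/

section L2

theorem L2_norm_sq_eq_integral_sq {α : Type*} [MeasurableSpace α] {μ : Measure α}
    (f : Lp ℝ 2 μ) : ‖f‖ ^ 2 = ∫ x, f x ^ 2 ∂μ := by
  rw [← real_inner_self_eq_norm_sq, L2.inner_def]
  refine integral_congr_ae (Filter.Eventually.of_forall fun x => ?_)
  simp [sq]

/-- An operator whose values are approximated, uniformly on the unit ball, by elements of a
finite-dimensional subspace is a norm limit of finite-rank operators: project to the subspaces. -/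
theorem isCompactOperator_of_exists_finiteDimensional_approx {H L : Type*}
    [NormedAddCommGroup H] [NormedSpace ℝ H] [NormedAddCommGroup L] [InnerProductSpace ℝ L]
    [CompleteSpace L] (J : H →L[ℝ] L)
    (h : ∀ δ > 0, ∃ S : Submodule ℝ L, FiniteDimensional ℝ S ∧
      ∀ x, ∃ v ∈ S, ‖J x - v‖ ≤ δ * ‖x‖) : IsCompactOperator J := by
  choose S hS hv using fun m : ℕ => h (1 / ((m : ℝ) + 1)) (by positivity)
  have hlim : Filter.Tendsto (fun m => (S m).starProjection.comp J) Filter.atTop (nhds J) := by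
    rw [tendsto_iff_norm_sub_tendsto_zero]
    refine squeeze_zero (fun _ => norm_nonneg _) (fun m => ?_)
      tendsto_one_div_add_atTop_nhds_zero_nat
    refine ContinuousLinearMap.opNorm_le_bound _ (by positivity) fun x => ?_
    obtain ⟨v, hvS, hvx⟩ := hv m x
    refine le_trans ?_ hvx
    rw [sub_apply, ContinuousLinearMap.comp_apply, norm_sub_rev, Submodule.starProjection_minimal]
    exact ciInf_le ⟨0, by rintro _ ⟨y, rfl⟩; exact norm_nonneg _⟩ (⟨v, hvS⟩ : S m)
  refine isCompactOperator_of_tendsto hlim (Filter.Eventually.of_forall fun m => ?_)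
  have : ProperSpace (S m) := FiniteDimensional.proper ℝ (S m)
  have h1 : IsCompactOperator (((S m).orthogonalProjectionOnto.comp J : H →L[ℝ] S m)) :=
    isCompactOperator_of_locallyCompactSpace_dom _
  exact h1.clm_comp (S m).subtypeL

end L2

section Compactness

variable {n : ℕ} {s : ℝ}

/-- Approximation of `𝓗₀ˢ(Ω)` by step functions on the grid of mesh `1 / N`. The approximant `v` takes
the average of `u` on each cube of a finite set covering `Ω`. -/
theorem exists_step_function_approx (hs : 0 < s) {Ω : Set (EuclideanSpace ℝ (Fin n))}
    (hΩ : Bornology.IsBounded Ω) {N : ℕ} (hN : 0 < N) :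
    ∃ S : Submodule ℝ (Lp ℝ 2 (volume : Measure (EuclideanSpace ℝ (Fin n)))),
      FiniteDimensional ℝ S ∧ ∀ u ∈ fracSobolevZero s Ω, ∃ v ∈ S,
        ‖u - v‖ ^ 2 ≤ (N : ℝ) ^ n * (√n / N) ^ ((n : ℝ) + 2 * s) *
          ∫ p, diffQuotient s u p ^ 2 := by
  obtain ⟨F, hF⟩ := exists_finset_subset_iUnion_gridCube hΩ N
  have hN' : (0 : ℝ) < N := Nat.cast_pos.2 hN
  have hm := measurableSet_gridCube (n := n) N
  have hfin : ∀ k : Fin n → ℤ, volume (gridCube N k) ≠ ∞ := fun k => by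
    rw [volume_gridCube hN]; exact ENNReal.ofReal_ne_top
  have hvol : ∀ k : Fin n → ℤ, volume.real (gridCube N k) = (N : ℝ)⁻¹ ^ n := fun k => by
    rw [measureReal_def, volume_gridCube hN, ENNReal.toReal_ofReal (by positivity)]
  let q : (Fin n → ℤ) → Lp ℝ 2 (volume : Measure (EuclideanSpace ℝ (Fin n))) :=
    fun k => indicatorConstLp 2 (hm k) (hfin k) 1
  refine ⟨Submodule.span ℝ (q '' F), FiniteDimensional.span_of_finite ℝ (F.finite_toSet.image q),
    fun u hu => ?_⟩
  let a : (Fin n → ℤ) → ℝ := fun k => (N : ℝ) ^ n * ∫ x in gridCube N k, u x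
  refine ⟨∑ k ∈ F, a k • q k, Submodule.sum_mem _ fun k hk => Submodule.smul_mem _ _
    (Submodule.subset_span ⟨k, hk, rfl⟩), ?_⟩
  set v := ∑ k ∈ F, a k • q k with hv
  have hvae : ∀ᵐ x, v x = ∑ k ∈ F, a k * (gridCube N k).indicator (fun _ => (1 : ℝ)) x := by
    have h1 : ∀ᵐ x, ∀ k ∈ F,
        (a k • q k) x = a k * (gridCube N k).indicator (fun _ => (1 : ℝ)) x := by
      rw [Filter.eventually_all_finset]
      intro k _
      filter_upwards [Lp.coeFn_smul (a k) (q k), indicatorConstLp_coeFn (p := 2) (hs := hm k)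
        (hμs := hfin k) (c := (1 : ℝ))] with x h1 h2
      rw [h1, Pi.smul_apply, h2, smul_eq_mul]
    filter_upwards [Lp.coeFn_finsetSum F fun k => a k • q k, h1] with x h2 h3
    rw [hv, h2, Finset.sum_apply]
    exact Finset.sum_congr rfl h3
  have hcube : ∀ᵐ x, (∀ k ∈ F, x ∈ gridCube N k → v x = a k) ∧
      (x ∉ ⋃ k ∈ F, gridCube N k → u x - v x = 0) := by
    filter_upwards [hvae, hu.2] with x h1 h2
    refine ⟨fun k hk hx => ?_, fun hx => ?_⟩
    · rw [h1, Finset.sum_eq_single k]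
      · simp [hx]
      · intro l _ hl
        have : x ∉ gridCube N l := fun hxl =>
          Set.disjoint_left.1 (pairwise_disjoint_gridCube N hl) hxl hx
        simp [this]
      · exact fun h => absurd hk h
    · rw [h1, h2 fun h => hx (hF h), Finset.sum_eq_zero, sub_zero]
      intro k hk
      have : x ∉ gridCube N k := fun h => hx (Set.mem_biUnion hk h)
      simp [this]
  have hint : Integrable (fun x => (u x - v x) ^ 2) := ((Lp.memLp u).sub (Lp.memLp v)).integrable_sq
  have hUm : MeasurableSet (⋃ k ∈ F, gridCube (n := n) N k) :=
    Finset.measurableSet_biUnion _ fun k _ => hm k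
  have e1 : ‖u - v‖ ^ 2 = ∑ k ∈ F, ∫ x in gridCube N k, (u x - v x) ^ 2 := by
    rw [L2_norm_sq_eq_integral_sq, ← integral_biUnion_finset F (fun k _ => hm k)
      (fun k _ l _ hkl => pairwise_disjoint_gridCube N hkl) (fun k _ => hint.integrableOn),
      setIntegral_eq_integral_of_ae_compl_eq_zero]
    · refine integral_congr_ae ?_
      filter_upwards [Lp.coeFn_sub u v] with x hx
      rw [hx, Pi.sub_apply]
    · filter_upwards [hcube] with x hx hx'
      rw [hx.2 hx', zero_pow two_ne_zero]
  have e2 : ∀ k ∈ F, ∫ x in gridCube N k, (u x - v x) ^ 2 ≤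
      (N : ℝ) ^ n * (√n / N) ^ ((n : ℝ) + 2 * s) *
        ∫ p in gridCube N k ×ˢ gridCube N k, diffQuotient s u p ^ 2 := fun k hk => by
    have : IsFiniteMeasure (volume.restrict (gridCube (n := n) N k)) :=
      ⟨by rw [Measure.restrict_apply_univ]; exact (hfin k).lt_top⟩
    have hreal : (volume.restrict (gridCube (n := n) N k)).real Set.univ = (N : ℝ)⁻¹ ^ n := by
      rw [measureReal_restrict_apply_univ, hvol]
    have h1 := integral_sq_sub_average_le (volume.restrict (gridCube N k))
      ((Lp.memLp u).restrict _) (by rw [hreal]; positivity)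
    rw [hreal, inv_pow, inv_inv, Measure.prod_restrict, ← Measure.volume_eq_prod] at h1
    have h2 := setIntegral_sq_sub_le hs hu.1 ((hm k).prod (hm k)) (d := √n / N)
      fun p hp => norm_sub_le_of_mem_gridCube hN hp.1 hp.2
    have h3 : ∫ x in gridCube N k, (u x - v x) ^ 2 = ∫ x in gridCube N k, (u x - a k) ^ 2 := by
      refine setIntegral_congr_ae (hm k) ?_
      filter_upwards [hcube] with x hx hxk
      rw [hx.1 k hk hxk]
    rw [h3, mul_assoc]
    exact h1.trans (mul_le_mul_of_nonneg_left h2 (by positivity))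
  have e3 : ∑ k ∈ F, ∫ p in gridCube N k ×ˢ gridCube N k, diffQuotient s u p ^ 2 ≤
      ∫ p, diffQuotient s u p ^ 2 := by
    rw [← integral_biUnion_finset F (fun k _ => (hm k).prod (hm k))
      (fun k _ l _ hkl => Set.disjoint_prod.2 (Or.inl (pairwise_disjoint_gridCube N hkl)))
      (fun k _ => hu.1.integrable_sq.integrableOn)]
    exact setIntegral_le_integral hu.1.integrable_sq
      (Filter.Eventually.of_forall fun p => sq_nonneg _)
  rw [e1]
  refine (Finset.sum_le_sum e2).trans ?_
  rw [← Finset.mul_sum]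
  exact mul_le_mul_of_nonneg_left e3 (by positivity)

/-- The bound on the squared error in `exists_step_function_approx` is a constant times `N ^ (-2 s)`. -/
theorem tendsto_grid_error (n : ℕ) (hs : 0 < s) :
    Filter.Tendsto (fun N : ℕ => (N : ℝ) ^ n * (√n / N) ^ ((n : ℝ) + 2 * s)) Filter.atTop
      (nhds 0) := by
  have h1 : Filter.Tendsto (fun N : ℕ => (√n) ^ ((n : ℝ) + 2 * s) * (N : ℝ) ^ (-(2 * s)))
      Filter.atTop (nhds 0) := by
    have := ((tendsto_rpow_neg_atTop (by positivity : 0 < 2 * s)).comp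
      tendsto_natCast_atTop_atTop).const_mul ((√n) ^ ((n : ℝ) + 2 * s))
    simpa using this
  refine h1.congr' ?_
  filter_upwards [Filter.eventually_gt_atTop 0] with N hN
  have hN' : (0 : ℝ) < N := Nat.cast_pos.2 hN
  rw [Real.div_rpow (Real.sqrt_nonneg _) hN'.le, Real.rpow_add hN', Real.rpow_neg hN'.le,
    Real.rpow_natCast]
  have : (N : ℝ) ^ (2 * s) ≠ 0 := (Real.rpow_pos_of_pos hN' _).ne'
  field_simp

end Compactness

/-! ### The energy space and the weighted operators -/

section EnergySpace

open scoped InnerProductSpace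

variable {n : ℕ} {s : ℝ}

/-- The difference quotient as a linear map from `𝓗₀ˢ(Ω)` to `L²(ℝⁿ × ℝⁿ)`. Up to the factor
`C_{n,s} / 2`, the energy form is the pullback of the inner product of `L²(ℝⁿ × ℝⁿ)`. -/
noncomputable def diffQuotientL2 (s : ℝ) (Ω : Set (EuclideanSpace ℝ (Fin n))) :
    fracSobolevZero s Ω →ₗ[ℝ]
      Lp ℝ 2 (volume : Measure (EuclideanSpace ℝ (Fin n) × EuclideanSpace ℝ (Fin n))) where
  toFun u := u.2.1.toLp (diffQuotient s u)
  map_add' u v := by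
    rw [← MemLp.toLp_add]
    refine MemLp.toLp_congr _ _ ?_
    rw [← diffQuotient_add]
    exact diffQuotient_congr s (Lp.coeFn_add _ _)
  map_smul' c u := by
    rw [RingHom.id_apply, ← MemLp.toLp_const_smul]
    refine MemLp.toLp_congr _ _ ?_
    rw [← diffQuotient_smul]
    exact diffQuotient_congr s (Lp.coeFn_smul _ _)

theorem coeFn_diffQuotientL2 (Ω : Set (EuclideanSpace ℝ (Fin n))) (u : fracSobolevZero s Ω) :
    diffQuotientL2 s Ω u =ᵐ[volume] diffQuotient s u.1 :=
  u.2.1.coeFn_toLp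

theorem norm_sq_diffQuotientL2 (Ω : Set (EuclideanSpace ℝ (Fin n))) (u : fracSobolevZero s Ω) :
    ‖diffQuotientL2 s Ω u‖ ^ 2 = ∫ p, diffQuotient s u.1 p ^ 2 := by
  rw [L2_norm_sq_eq_integral_sq]
  refine integral_congr_ae ?_
  filter_upwards [coeFn_diffQuotientL2 Ω u] with p hp
  rw [hp]

theorem fracForm_eq_inner_diffQuotientL2 (Ω : Set (EuclideanSpace ℝ (Fin n)))
    (u v : fracSobolevZero s Ω) :
    fracForm s u.1 v.1 =
      fracLaplacianConst n s / 2 * ⟪diffQuotientL2 s Ω u, diffQuotientL2 s Ω v⟫_ℝ := by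
  rw [fracForm_eq_integral_diffQuotient, L2.inner_def]
  congr 1
  refine integral_congr_ae ?_
  filter_upwards [coeFn_diffQuotientL2 Ω u, coeFn_diffQuotientL2 Ω v] with p h1 h2
  simp [h1, h2, mul_comm]

theorem exists_norm_le_norm_diffQuotientL2 (hn : 1 ≤ n) (hs : 0 < s)
    {Ω : Set (EuclideanSpace ℝ (Fin n))} (hΩm : MeasurableSet Ω) (hΩ : Bornology.IsBounded Ω) :
    ∃ C : ℝ, ∀ u : fracSobolevZero s Ω, ‖u.1‖ ≤ C * ‖diffQuotientL2 s Ω u‖ := by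
  obtain ⟨C, hC0, hC⟩ := exists_integral_sq_le_integral_sq_diffQuotient hn hs hΩm hΩ
  refine ⟨√C, fun u => ?_⟩
  have h := hC u.1 u.2
  rw [← L2_norm_sq_eq_integral_sq, ← norm_sq_diffQuotientL2] at h
  refine le_of_sq_le_sq ?_ (by positivity)
  rwa [mul_pow, Real.sq_sqrt hC0]

/-- `𝓗₀ˢ(Ω)` is complete for the energy norm: by the Poincaré inequality convergence of the difference
quotients implies convergence in `L²(ℝⁿ)`, and the limits match along a subsequence that converges
almost everywhere. -/
theorem isClosed_range_diffQuotientL2 (hn : 1 ≤ n) (hs : 0 < s)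
    {Ω : Set (EuclideanSpace ℝ (Fin n))} (hΩm : MeasurableSet Ω) (hΩ : Bornology.IsBounded Ω) :
    IsClosed (LinearMap.range (diffQuotientL2 s Ω) : Set (Lp ℝ 2
      (volume : Measure (EuclideanSpace ℝ (Fin n) × EuclideanSpace ℝ (Fin n))))) := by
  obtain ⟨C, hC⟩ := exists_norm_le_norm_diffQuotientL2 hn hs hΩm hΩ
  refine IsSeqClosed.isClosed fun g g' hg hlim => ?_
  choose u hu using hg
  have hcauchy : CauchySeq fun j => (u j).1 := by
    rw [Metric.cauchySeq_iff]
    intro δ hδ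
    obtain ⟨N, hN⟩ := Metric.cauchySeq_iff.1 hlim.cauchySeq (δ / (|C| + 1)) (by positivity)
    refine ⟨N, fun i hi j hj => ?_⟩
    have h1 := hN i hi j hj
    have h2 := hC (u i - u j)
    rw [map_sub, hu, hu] at h2
    rw [dist_eq_norm] at h1 ⊢
    rw [lt_div_iff₀ (by positivity)] at h1
    have h3 := le_abs_self C
    have h4 := norm_nonneg (g i - g j)
    have h5 : ‖(u i).1 - (u j).1‖ ≤ C * ‖g i - g j‖ := h2
    nlinarith
  obtain ⟨u', hu'⟩ := cauchySeq_tendsto_of_complete hcauchy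
  obtain ⟨θ, hθ, hθlim⟩ := (tendstoInMeasure_of_tendsto_Lp hu').exists_seq_tendsto_ae
  obtain ⟨θ', hθ', hθlim'⟩ := (tendstoInMeasure_of_tendsto_Lp
    (hlim.comp hθ.tendsto_atTop)).exists_seq_tendsto_ae
  have hfst := (Measure.quasiMeasurePreserving_fst
    (μ := (volume : Measure (EuclideanSpace ℝ (Fin n))))
    (ν := (volume : Measure (EuclideanSpace ℝ (Fin n))))).ae hθlim
  have hsnd := (Measure.quasiMeasurePreserving_snd
    (μ := (volume : Measure (EuclideanSpace ℝ (Fin n))))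
    (ν := (volume : Measure (EuclideanSpace ℝ (Fin n))))).ae hθlim
  have hquot : ∀ᵐ p : EuclideanSpace ℝ (Fin n) × EuclideanSpace ℝ (Fin n),
      ∀ j, g j p = diffQuotient s (u j).1 p := ae_all_iff.2 fun j => by
    rw [← hu]
    exact coeFn_diffQuotientL2 Ω (u j)
  have heq : g' =ᵐ[volume] diffQuotient s u' := by
    rw [← Measure.volume_eq_prod] at hfst hsnd
    filter_upwards [hfst, hsnd, hθlim', hquot] with p h1 h2 h3 h4
    refine tendsto_nhds_unique h3 ?_
    simp only [Function.comp_apply, h4]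
    exact ((h1.sub h2).div_const _).comp hθ'.tendsto_atTop
  have hmem : u' ∈ fracSobolevZero s Ω := by
    refine ⟨(memLp_congr_ae heq).1 (Lp.memLp g'), ?_⟩
    have h0 : ∀ᵐ x, ∀ j, x ∉ Ω → (u j).1 x = 0 := ae_all_iff.2 fun j => (u j).2.2
    filter_upwards [hθlim, h0] with x h1 h2 hx
    refine tendsto_nhds_unique h1 ?_
    simp only [h2 _ hx]
    exact tendsto_const_nhds
  refine ⟨⟨u', hmem⟩, Lp.ext ?_⟩
  exact (coeFn_diffQuotientL2 Ω ⟨u', hmem⟩).trans heq.symm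

theorem memLp_boundedContinuous_mul {α : Type*} [TopologicalSpace α] [MeasurableSpace α]
    [BorelSpace α] {μ : Measure α} (w : α →ᵇ ℝ) (f : Lp ℝ 2 μ) :
    MemLp (fun x => w x * f x) 2 μ := by
  refine (Lp.memLp f).of_le_mul (c := ‖w‖)
    (w.continuous.aestronglyMeasurable.mul (Lp.aestronglyMeasurable f))
    (Filter.Eventually.of_forall fun x => ?_)
  rw [norm_mul]
  gcongr
  exact w.norm_coe_le_norm x

/-- Multiplication by a bounded continuous function on `L²`, as a bilinear map. -/
noncomputable def mulL2 {α : Type*} [TopologicalSpace α] [MeasurableSpace α] [BorelSpace α]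
    (μ : Measure α) : (α →ᵇ ℝ) →L[ℝ] Lp ℝ 2 μ →L[ℝ] Lp ℝ 2 μ :=
  LinearMap.mkContinuous₂ (LinearMap.mk₂ ℝ (fun w f => (memLp_boundedContinuous_mul w f).toLp _)
    (fun w w' f => by
      rw [← MemLp.toLp_add]
      exact MemLp.toLp_congr _ _ (Filter.Eventually.of_forall fun x => add_mul _ _ _))
    (fun c w f => by
      rw [← MemLp.toLp_const_smul]
      exact MemLp.toLp_congr _ _ (Filter.Eventually.of_forall fun x => mul_assoc _ _ _))
    (fun w f f' => by
      rw [← MemLp.toLp_add]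
      refine MemLp.toLp_congr _ _ ?_
      filter_upwards [Lp.coeFn_add f f'] with x hx
      simp only [hx, Pi.add_apply, mul_add])
    (fun c w f => by
      rw [← MemLp.toLp_const_smul]
      refine MemLp.toLp_congr _ _ ?_
      filter_upwards [Lp.coeFn_smul c f] with x hx
      simp only [hx, Pi.smul_apply, smul_eq_mul, mul_left_comm])) 1 (fun w f => by
    rw [one_mul]
    refine Lp.norm_le_mul_norm_of_ae_le_mul ?_
    filter_upwards [(memLp_boundedContinuous_mul w f).coeFn_toLp] with x hx
    rw [LinearMap.mk₂_apply, hx, norm_mul]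
    gcongr
    exact w.norm_coe_le_norm x)

theorem coeFn_mulL2 {α : Type*} [TopologicalSpace α] [MeasurableSpace α] [BorelSpace α]
    (μ : Measure α) (w : α →ᵇ ℝ) (f : Lp ℝ 2 μ) : mulL2 μ w f =ᵐ[μ] fun x => w x * f x :=
  (memLp_boundedContinuous_mul w f).coeFn_toLp

theorem inner_mulL2 {α : Type*} [TopologicalSpace α] [MeasurableSpace α] [BorelSpace α]
    (μ : Measure α) (w : α →ᵇ ℝ) (f g : Lp ℝ 2 μ) :
    ⟪mulL2 μ w f, g⟫_ℝ = ∫ x, w x * f x * g x ∂μ := by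
  rw [L2.inner_def]
  refine integral_congr_ae ?_
  filter_upwards [coeFn_mulL2 μ w f] with x hx
  simp [hx, mul_comm]

/-- The operator `J† ∘ (multiplication by w) ∘ J` on `H`, linear in the weight `w`; it represents the
form `∫ w (J x) (J y)` with respect to the inner product of `H`. -/
noncomputable def weightedOperator {α H : Type*} [TopologicalSpace α] [MeasurableSpace α]
    [BorelSpace α] {μ : Measure α} [NormedAddCommGroup H] [InnerProductSpace ℝ H] [CompleteSpace H]
    (J : H →L[ℝ] Lp ℝ 2 μ) : (α →ᵇ ℝ) →L[ℝ] H →L[ℝ] H :=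
  (ContinuousLinearMap.compL ℝ H (Lp ℝ 2 μ) H (ContinuousLinearMap.adjoint J)).comp
    (((ContinuousLinearMap.compL ℝ H (Lp ℝ 2 μ) (Lp ℝ 2 μ)).flip J).comp (mulL2 μ))

section

variable {α H : Type*} [TopologicalSpace α] [MeasurableSpace α]
    [BorelSpace α] {μ : Measure α} [NormedAddCommGroup H] [InnerProductSpace ℝ H] [CompleteSpace H]
    (J : H →L[ℝ] Lp ℝ 2 μ)

theorem inner_weightedOperator (w : α →ᵇ ℝ) (x y : H) :
    ⟪weightedOperator J w x, y⟫_ℝ = ∫ a, w a * J x a * J y a ∂μ := by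
  rw [← inner_mulL2, ← ContinuousLinearMap.adjoint_inner_left]
  rfl

theorem isSymmetric_weightedOperator (w : α →ᵇ ℝ) :
    (weightedOperator J w : H →ₗ[ℝ] H).IsSymmetric := fun x y => by
  rw [ContinuousLinearMap.coe_coe, real_inner_comm _ x, inner_weightedOperator,
    inner_weightedOperator]
  simp only [mul_right_comm]

theorem isCompactOperator_weightedOperator (hJ : IsCompactOperator J) (w : α →ᵇ ℝ) :
    IsCompactOperator (weightedOperator J w) :=
  hJ.clm_comp ((ContinuousLinearMap.adjoint J).comp (mulL2 μ w))

end

end EnergySpace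

/-! ### Simplicity of the weighted eigenvalues -/

section Assembly

open scoped InnerProductSpace

variable {n : ℕ} {s : ℝ}

/-- A subspace without orthonormal pairs has dimension at most one. -/
theorem exists_smul_eq_of_inner_ne_zero {H : Type*} [NormedAddCommGroup H]
    [InnerProductSpace ℝ H] {W : Submodule ℝ H}
    (hW : ∀ φ ∈ W, ∀ ψ ∈ W, ‖φ‖ = 1 → ‖ψ‖ = 1 → ⟪φ, ψ⟫_ℝ ≠ 0) {φ ψ : H} (hφ : φ ∈ W)
    (hψ : ψ ∈ W) (hφ0 : φ ≠ 0) : ∃ c : ℝ, c • φ = ψ := by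
  refine ⟨⟪φ, ψ⟫_ℝ / ‖φ‖ ^ 2, ?_⟩
  by_contra hne
  set χ := ψ - (⟪φ, ψ⟫_ℝ / ‖φ‖ ^ 2) • φ with hχ
  have hχ0 : χ ≠ 0 := fun h => hne (sub_eq_zero.1 h).symm
  have horth : ⟪φ, χ⟫_ℝ = 0 := by
    have : ‖φ‖ ≠ 0 := norm_ne_zero_iff.2 hφ0
    rw [hχ, inner_sub_right, real_inner_smul_right, real_inner_self_eq_norm_sq]
    field_simp
    ring
  refine hW (‖φ‖⁻¹ • φ) (W.smul_mem _ hφ) (‖χ‖⁻¹ • χ)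
    (W.smul_mem _ (W.sub_mem hψ (W.smul_mem _ hφ))) ?_ ?_ ?_
  · exact norm_smul_inv_norm (𝕜 := ℝ) hφ0
  · exact norm_smul_inv_norm (𝕜 := ℝ) hχ0
  · rw [real_inner_smul_left, real_inner_smul_right, horth, mul_zero, mul_zero]

/-- A sequence of bounded continuous functions on the whole space whose restrictions to `K` are dense:
Tietze extensions of a dense sequence of `C(K, ℝ)`. -/
theorem exists_seq_dense_on_compact {E : Type*} [MetricSpace E] {K : Set E} (hK : IsCompact K) :
    ∃ c : ℕ → E →ᵇ ℝ, ∀ w : E →ᵇ ℝ, ∀ η > 0, ∃ j, ∀ x ∈ K, |w x - c j x| ≤ η := by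
  have : CompactSpace K := isCompact_iff_compactSpace.1 hK
  choose g _ hg using fun j => BoundedContinuousFunction.exists_norm_eq_domRestrict_eq_of_closed
    (BoundedContinuousFunction.mkOfCompact (TopologicalSpace.denseSeq C(K, ℝ) j)) hK.isClosed
  refine ⟨g, fun w η hη => ?_⟩
  obtain ⟨j, hj⟩ := (TopologicalSpace.denseRange_denseSeq C(K, ℝ)).exists_dist_lt
    (w.toContinuousMap.restrict K) hη
  refine ⟨j, fun x hx => ?_⟩
  have h1 : g j x = TopologicalSpace.denseSeq C(K, ℝ) j ⟨x, hx⟩ :=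
    DFunLike.congr_fun (hg j) (⟨x, hx⟩ : K)
  have h2 := ContinuousMap.dist_apply_le_dist (f := w.toContinuousMap.restrict K)
    (g := TopologicalSpace.denseSeq C(K, ℝ) j) ⟨x, hx⟩
  rw [Real.dist_eq] at h2
  rw [h1]
  exact h2.trans hj.le

theorem ae_eq_zero_of_forall_integral_seq_mul_eq_zero {K : Set (EuclideanSpace ℝ (Fin n))}
    {c : ℕ → EuclideanSpace ℝ (Fin n) →ᵇ ℝ}
    (hc : ∀ w : EuclideanSpace ℝ (Fin n) →ᵇ ℝ, ∀ η > 0, ∃ j, ∀ x ∈ K, |w x - c j x| ≤ η)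
    {h : EuclideanSpace ℝ (Fin n) → ℝ} (hh : Integrable h) (hK : ∀ᵐ x, x ∉ K → h x = 0)
    (h0 : ∀ j, ∫ x, c j x * h x = 0) : ∀ᵐ x, h x = 0 := by
  have hmul : ∀ w : EuclideanSpace ℝ (Fin n) →ᵇ ℝ, Integrable fun x => w x * h x := fun w =>
    hh.bdd_mul w.continuous.aestronglyMeasurable (Filter.Eventually.of_forall w.norm_coe_le_norm)
  refine ae_eq_zero_of_integral_contDiff_smul_eq_zero hh.locallyIntegrable fun g hg hgc => ?_
  obtain ⟨B, hB⟩ := hgc.exists_bound_of_continuous hg.continuous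
  let w := BoundedContinuousFunction.ofNormedAddCommGroup g hg.continuous B hB
  have hw : ∀ x, w x = g x := fun _ => rfl
  simp only [smul_eq_mul, ← hw]
  refine abs_nonpos_iff.1 (le_of_forall_pos_le_add fun δ hδ => ?_)
  have hI : 0 ≤ ∫ x, |h x| := integral_nonneg fun x => abs_nonneg _
  obtain ⟨j, hj⟩ := hc w (δ / ((∫ x, |h x|) + 1)) (by positivity)
  have e1 : ∫ x, w x * h x = ∫ x, (w x - c j x) * h x := by
    simp only [sub_mul]
    rw [integral_sub (hmul _) (hmul _), h0, sub_zero]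
  rw [e1, zero_add]
  calc |∫ x, (w x - c j x) * h x| ≤ ∫ x, |(w x - c j x) * h x| := abs_integral_le_integral_abs
    _ ≤ ∫ x, δ / ((∫ x, |h x|) + 1) * |h x| := by
        refine integral_mono_of_nonneg (Filter.Eventually.of_forall fun x => abs_nonneg _)
          (hh.abs.const_mul _) ?_
        filter_upwards [hK] with x hx
        rw [abs_mul]
        by_cases hxK : x ∈ K
        · exact mul_le_mul_of_nonneg_right (hj x hxK) (abs_nonneg _)
        · rw [hx hxK, abs_zero, mul_zero, mul_zero]
    _ = δ * ((∫ x, |h x|) / ((∫ x, |h x|) + 1)) := by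
        rw [integral_const_mul]
        ring
    _ ≤ δ := mul_le_of_le_one_right hδ.le ((div_le_one (by positivity)).2 (by linarith))

/-- If `‖u‖ ≤ C ‖D u‖` on a subspace `V` of `L`, the map `D u ↦ u` is well defined and bounded on the
range of `D`; it is compact if the elements of `V` are approximated from finite-dimensional subspaces
with an error small relative to `‖D u‖`. -/
theorem exists_compact_leftInverse {L G : Type*} [NormedAddCommGroup L] [InnerProductSpace ℝ L]
    [CompleteSpace L] [NormedAddCommGroup G] [NormedSpace ℝ G] {V : Submodule ℝ L}
    (D : V →ₗ[ℝ] G) {C : ℝ} (hC : ∀ u, ‖u.1‖ ≤ C * ‖D u‖)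
    (happrox : ∀ δ > 0, ∃ S : Submodule ℝ L, FiniteDimensional ℝ S ∧
      ∀ u : V, ∃ v ∈ S, ‖u.1 - v‖ ≤ δ * ‖D u‖) :
    ∃ J : LinearMap.range D →L[ℝ] L,
      IsCompactOperator J ∧ ∀ u, J (D.rangeRestrict u) = u.1 := by
  have hinj : Function.Injective D := by
    rw [injective_iff_map_eq_zero]
    intro u hu
    have h := hC u
    rw [hu, norm_zero, mul_zero, norm_le_zero_iff] at h
    exact Subtype.ext h
  let e := LinearEquiv.ofInjective D hinj
  let J := (V.subtype ∘ₗ e.symm.toLinearMap).mkContinuous C fun x => by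
    obtain ⟨u, rfl⟩ := e.surjective x
    simpa [e] using hC u
  have hJ : ∀ u, J (D.rangeRestrict u) = u.1 := fun u =>
    congrArg Subtype.val (e.symm_apply_apply u)
  refine ⟨J, isCompactOperator_of_exists_finiteDimensional_approx J fun δ hδ => ?_, hJ⟩
  obtain ⟨S, hS, hSv⟩ := happrox δ hδ
  refine ⟨S, hS, fun x => ?_⟩
  obtain ⟨u, rfl⟩ := D.surjective_rangeRestrict x
  obtain ⟨v, hv, hle⟩ := hSv u
  exact ⟨v, hv, by rw [hJ]; exact hle⟩

/-- The Hilbert space `H` obtained from `𝓗₀ˢ(Ω)` with the energy inner product (without its constant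
factor), and the compact inclusion `J` of `H` into `L²(ℝⁿ)`. It is the range of `diffQuotientL2`, but
only the properties listed here are used. -/
theorem exists_energySpace (hn : 1 ≤ n) (hs : 0 < s)
    {Ω : Set (EuclideanSpace ℝ (Fin n))} (hΩm : MeasurableSet Ω) (hΩ : Bornology.IsBounded Ω) :
    ∃ (H : Type) (_ : NormedAddCommGroup H) (_ : InnerProductSpace ℝ H) (_ : CompleteSpace H)
      (D : fracSobolevZero s Ω →ₗ[ℝ] H)
      (J : H →L[ℝ] Lp ℝ 2 (volume : Measure (EuclideanSpace ℝ (Fin n)))),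
      Function.Surjective D ∧ IsCompactOperator J ∧ (∀ u, J (D u) = u.1) ∧
      ∀ u v, fracForm s u.1 v.1 = fracLaplacianConst n s / 2 * ⟪D u, D v⟫_ℝ := by
  obtain ⟨C, hC⟩ := exists_norm_le_norm_diffQuotientL2 hn hs hΩm hΩ
  obtain ⟨J, hJc, hJ⟩ := exists_compact_leftInverse (diffQuotientL2 s Ω) hC fun δ hδ => by
    obtain ⟨N, hN, hN0⟩ := (((tendsto_grid_error n hs).eventually_lt_const
      (sq_pos_of_pos hδ)).and (Filter.eventually_gt_atTop 0)).exists
    obtain ⟨S, hS, happrox⟩ := exists_step_function_approx hs hΩ hN0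
    refine ⟨S, hS, fun u => ?_⟩
    obtain ⟨v, hv, hle⟩ := happrox u.1 u.2
    refine ⟨v, hv, le_of_sq_le_sq (hle.trans ?_) (by positivity)⟩
    rw [mul_pow, ← norm_sq_diffQuotientL2]
    exact mul_le_mul_of_nonneg_right hN.le (sq_nonneg _)
  exact ⟨LinearMap.range (diffQuotientL2 s Ω), inferInstance, inferInstance,
    (isClosed_range_diffQuotientL2 hn hs hΩm hΩ).completeSpace_coe,
    (diffQuotientL2 s Ω).rangeRestrict, J, (diffQuotientL2 s Ω).surjective_rangeRestrict, hJc, hJ,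
    fracForm_eq_inner_diffQuotientL2 Ω⟩

theorem fracLaplacianConst_pos (n : ℕ) (hs0 : 0 < s) (hs1 : s < 1) :
    0 < fracLaplacianConst n s := by
  have h1 : 0 < Real.Gamma (s + (n : ℝ) / 2) := Real.Gamma_pos_of_pos (by positivity)
  have h2 : 0 < Real.Gamma (1 - s) := Real.Gamma_pos_of_pos (by linarith)
  have := Real.pi_pos
  unfold fracLaplacianConst
  positivity

/-- The weak formulation, written as an eigenvalue equation for `weightedOperator J b`. Only the values
of the weight on `Ω` matter, so the weight `w` of the problem need not be bounded. -/
theorem weightedOperator_eq_smul_of_isWeakEigenSolution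
    {Ω : Set (EuclideanSpace ℝ (Fin n))} (hΩm : MeasurableSet Ω)
    {H : Type*} [NormedAddCommGroup H] [InnerProductSpace ℝ H] [CompleteSpace H]
    {D : fracSobolevZero s Ω →ₗ[ℝ] H}
    {J : H →L[ℝ] Lp ℝ 2 (volume : Measure (EuclideanSpace ℝ (Fin n)))}
    (hD : Function.Surjective D) (hJ : ∀ u, J (D u) = u.1)
    (hform : ∀ u v : fracSobolevZero s Ω,
      fracForm s u.1 v.1 = fracLaplacianConst n s / 2 * ⟪D u, D v⟫_ℝ)
    {w : EuclideanSpace ℝ (Fin n) → ℝ} {b : EuclideanSpace ℝ (Fin n) →ᵇ ℝ}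
    (hwb : ∀ x ∈ Ω, w x = b x) {lam : ℝ} (u : fracSobolevZero s Ω)
    (hu : IsWeakEigenSolution s Ω w lam u.1) :
    lam • weightedOperator J b (D u) = (fracLaplacianConst n s / 2) • D u := by
  refine ext_inner_right ℝ fun y => ?_
  obtain ⟨v, rfl⟩ := hD y
  rw [real_inner_smul_left, real_inner_smul_left, inner_weightedOperator, hJ, hJ]
  have h := hu.2 v.1 v.2
  rw [hform] at h
  have h1 : ∫ x in Ω, w x * u.1 x * v.1 x = ∫ x, b x * u.1 x * v.1 x := by
    have h2 : ∫ x in Ω, w x * u.1 x * v.1 x = ∫ x in Ω, b x * u.1 x * v.1 x :=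
      setIntegral_congr_fun hΩm fun x hx => by simp only [hwb x hx]
    rw [h2, setIntegral_eq_integral_of_ae_compl_eq_zero]
    filter_upwards [v.2.2] with x hx hxΩ
    rw [hx hxΩ, mul_zero]
  rw [← h1, ← h]

end Assembly

theorem theorem4 (n : ℕ) (hn : 1 ≤ n) (s : ℝ) (hs0 : 0 < s) (hs1 : s < 1)
    (Ω : Set (EuclideanSpace ℝ (Fin n))) (hΩopen : IsOpen Ω) (hΩ : Bornology.IsBounded Ω)
    (α : C(EuclideanSpace ℝ (Fin n), ℝ)) (hα : ∀ x ∈ closure Ω, 0 < α x)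
    (ε : ℝ) (hε : 0 < ε) :
    ∃ β : EuclideanSpace ℝ (Fin n) →ᵇ ℝ, ‖β‖ < ε ∧
      ∀ lam : ℝ, IsWeightedEigenvalue s Ω (α + β.toContinuousMap) lam →
        Module.finrank ℝ (weightedEigenspace s Ω hΩ (α + β.toContinuousMap) lam) = 1 := by
  have hΩm := hΩopen.measurableSet
  have hK : IsCompact (closure Ω) := hΩ.isCompact_closure
  obtain ⟨H, _, _, _, D, J, hD, hJc, hJ, hform⟩ := exists_energySpace hn hs0 hΩm hΩ
  obtain ⟨c, hc⟩ := exists_seq_dense_on_compact hK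
  have hsep : ∀ φ ψ : H,
      (∀ j, inner ℝ (weightedOperator J (c j) φ) φ = inner ℝ (weightedOperator J (c j) ψ) ψ) →
      (∀ j, inner ℝ (weightedOperator J (c j) φ) ψ = 0) → φ = 0 := by
    intro φ ψ h1 h2
    obtain ⟨u, rfl⟩ := hD φ
    obtain ⟨v, rfl⟩ := hD ψ
    simp only [inner_weightedOperator, hJ] at h1 h2
    have hint : ∀ f g : Lp ℝ 2 (volume : Measure (EuclideanSpace ℝ (Fin n))),
        Integrable fun x => f x * g x := fun f g => (Lp.memLp f).integrable_mul (Lp.memLp g)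
    have hint' : ∀ j, ∀ f g : Lp ℝ 2 (volume : Measure (EuclideanSpace ℝ (Fin n))),
        Integrable fun x => c j x * f x * g x := fun j f g =>
      (memLp_boundedContinuous_mul (c j) f).integrable_mul (Lp.memLp g)
    have hsq := ae_eq_zero_of_forall_integral_seq_mul_eq_zero hc
      (h := fun x => u.1 x * u.1 x - v.1 x * v.1 x) ((hint _ _).sub (hint _ _)) (by
        filter_upwards [u.2.2, v.2.2] with x hx hx' hxK
        have hxΩ : x ∉ Ω := fun h => hxK (subset_closure h)
        rw [hx hxΩ, hx' hxΩ, sub_self]) fun j => by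
        simp only [mul_sub, ← mul_assoc]
        rw [integral_sub (hint' _ _ _) (hint' _ _ _), h1, sub_self]
    have hprod := ae_eq_zero_of_forall_integral_seq_mul_eq_zero hc
      (h := fun x => u.1 x * v.1 x) (hint _ _) (by
        filter_upwards [u.2.2] with x hx hxK
        rw [hx fun h => hxK (subset_closure h), zero_mul]) fun j => by
        simp only [← mul_assoc]
        exact h2 j
    -- `u² = v²` and `u v = 0` almost everywhere.
    have hu0 : u = 0 := by
      refine Subtype.ext (Lp.ext ?_)
      filter_upwards [hsq, hprod, Lp.coeFn_zero ℝ 2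
        (volume : Measure (EuclideanSpace ℝ (Fin n)))] with x h3 h4 h5
      refine Eq.trans ?_ h5.symm
      rcases mul_eq_zero.1 h4 with h6 | h6
      · exact h6
      · rw [h6, mul_zero, sub_zero] at h3
        exact mul_self_eq_zero.1 h3
    rw [hu0, map_zero]
  have hdense := dense_setOf_simple_eigenvalues (weightedOperator J)
    (isCompactOperator_weightedOperator J hJc) (isSymmetric_weightedOperator J) c hsep
  have : CompactSpace (closure Ω) := isCompact_iff_compactSpace.1 hK
  -- `α` may be unbounded, so it is replaced by a bounded extension of its restriction.
  obtain ⟨α', -, hα'⟩ := BoundedContinuousFunction.exists_norm_eq_domRestrict_eq_of_closed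
    (BoundedContinuousFunction.mkOfCompact (α.restrict (closure Ω))) isClosed_closure
  have hα'' : ∀ x ∈ closure Ω, α' x = α x := fun x hx =>
    DFunLike.congr_fun hα' (⟨x, hx⟩ : closure Ω)
  obtain ⟨δ, hδ, hδα⟩ := hK.exists_forall_le' α.continuous.continuousOn hα
  obtain ⟨b, hb, hdist⟩ := hdense.exists_dist_lt α' (lt_min hε hδ)
  rw [dist_comm, dist_eq_norm, lt_min_iff] at hdist
  refine ⟨b - α', hdist.1, ?_⟩
  have hw : ∀ x ∈ Ω, (α + (b - α').toContinuousMap) x = b x := fun x hx => by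
    change α x + (b x - α' x) = b x
    rw [hα'' x (subset_closure hx)]
    ring
  have hbpos : ∀ x ∈ Ω, 0 ≤ b x := fun x hx => by
    have h1 := (b - α').norm_coe_le_norm x
    rw [BoundedContinuousFunction.sub_apply, hα'' x (subset_closure hx), Real.norm_eq_abs] at h1
    have h2 := neg_abs_le (b x - α x)
    have h3 := hδα x (subset_closure hx)
    linarith [hdist.2]
  rintro lam ⟨φ, hφ0, hφ⟩
  have hC := fracLaplacianConst_pos n hs0 hs1
  have hx0 : D ⟨φ, hφ.1⟩ ≠ 0 := fun h => by
    have h1 := hJ ⟨φ, hφ.1⟩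
    rw [h, map_zero] at h1
    exact hφ0 h1.symm
  have hop := fun (ψ : Lp ℝ 2 (volume : Measure (EuclideanSpace ℝ (Fin n))))
    (hψ : IsWeakEigenSolution s Ω (α + (b - α').toContinuousMap) lam ψ) =>
    weightedOperator_eq_smul_of_isWeakEigenSolution hΩm hD hJ hform hw ⟨ψ, hψ.1⟩ hψ
  -- Since the perturbed weight is nonnegative on `Ω`, eigenvalues are positive.
  have hlam : 0 < lam := by
    have h1 := congrArg (fun y => inner ℝ y (D ⟨φ, hφ.1⟩))
      (hop φ hφ)
    simp only [real_inner_smul_left, real_inner_self_eq_norm_sq, inner_weightedOperator, hJ] at h1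
    have h2 : 0 ≤ ∫ x, b x * φ x * φ x := by
      refine integral_nonneg_of_ae ?_
      filter_upwards [hφ.1.2] with x hx
      by_cases hxΩ : x ∈ Ω
      · rw [mul_assoc]
        exact mul_nonneg (hbpos x hxΩ) (mul_self_nonneg _)
      · rw [hx hxΩ, mul_zero]
        rfl
    have h3 : 0 < lam * ∫ x, b x * φ x * φ x := by
      rw [h1]
      have := norm_pos_iff.2 hx0
      positivity
    by_contra! h4
    exact absurd (mul_nonpos_of_nonpos_of_nonneg h4 h2) h3.not_ge
  have heig : ∀ (ψ : Lp ℝ 2 (volume : Measure (EuclideanSpace ℝ (Fin n))))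
      (hψ : IsWeakEigenSolution s Ω (α + (b - α').toContinuousMap) lam ψ),
      D ⟨ψ, hψ.1⟩ ∈ Module.End.eigenspace
        (weightedOperator J b : Module.End ℝ H)
        (lam⁻¹ * (fracLaplacianConst n s / 2)) := fun ψ hψ => by
    rw [Module.End.mem_eigenspace_iff, mul_smul, ← hop ψ hψ, inv_smul_smul₀ hlam.ne']
    rfl
  rw [finrank_eq_one_iff_of_nonzero'
    (⟨φ, hφ⟩ : weightedEigenspace s Ω hΩ (α + (b - α').toContinuousMap) lam)
    fun h => hφ0 (congrArg Subtype.val h)]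
  rintro ⟨ψ, hψ⟩
  obtain ⟨a, ha⟩ := exists_smul_eq_of_inner_ne_zero (fun x hx y hy => hb _ (by positivity) x y
    (Module.End.mem_eigenspace_iff.1 hx) (Module.End.mem_eigenspace_iff.1 hy))
    (heig φ hφ) (heig ψ hψ) hx0
  refine ⟨a, Subtype.ext ?_⟩
  have h1 := congrArg J ha
  rw [map_smul, hJ, hJ] at h1
  exact h1
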